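/- Let $U=U_h(\mathfrak{sl}_2)$ be the $\mathbb{C}[[h]]$-algebra topologically generated (in the $h$-adic topology) by $x,y,H$ with relations $$Hx-xH=2x,\qquad Hy-yH=-2y,\qquad xy-yx=\frac{e^{\frac h2 H}-e^{-\frac h2 H}}{e^{\frac h2}-e^{-\frac h2}},$$ that is, the quotient of $\mathbb{C}\langle x,y,H\rangle[[h]]$ by the $h$-adic closure of the two-sided ideal generated by these relations. Put $q=e^{h/2}$, $k=e^{\frac h4 H}$, $[n]=\frac{q^n-q^{-n}}{q-q^{-1}}$, $[n]!=\prod_{i=1}^n[i]$, and let $\hat\otimes$ be the $h$-adically completed tensor product over $\mathbb{C}[[h]]$. There is exactly one (topological) Hopf algebra structure on $U$ over $\mathbb{C}[[h]]$, with coproduct $\Delta\colon U\to U\hat\otimes U$, counit $\varepsilon\colon U\to\mathbb{C}[[h]]$ and antipode $S\colon U\to U$, such that $$\Delta(x)=x\otimes k+k^{-1}\otimes x,\quad \Delta(y)=y\otimes k+k^{-1}\otimes y,\quad \Delta(H)=H\otimes 1+1\otimes H,$$ $$S(x)=-qx,\quad S(y)=-q^{-1}y,\quad S(H)=-H,\qquad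 \varepsilon(x)=\varepsilon(y)=\varepsilon(H)=0.$$ For this Hopf algebra structure the element $$R=e^{\frac h4 H\otimes H}\sum_{n\ge 0}\frac{(q-q^{-1})^n}{[n]!}\,q^{\frac12 n(n-3)}\,(kx)^n\otimes(k^{-1}y)^n\ \in\ U\hat\otimes U$$ is a universal $R$-matrix: $R$ is invertible, $(\tau\circ\Delta)(a)=R\,\Delta(a)\,R^{-1}$ for every $a\in U$, where $\tau(a\otimes b)=b\otimes a$, and $$(\Delta\otimes\mathrm{id})(R)=R_{13}R_{23},\qquad (\mathrm{id}\otimes\Delta)(R)=R_{13}R_{12}.$$ Moreover $$R=e^{\frac h4 H\otimes H}\,\mathrm{Exp}_q\!\left(\lambda_q\,kx\otimes k^{-1}y\right),\qquad \lambda_q=q^{-1}(q-q^{-1}),\qquad \mathrm{Exp}_q(z)=\sum_{n\ge0}\frac{q^{\frac12 n(n-1)}}{[n]!}z^n .$$ -/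

import Mathlib

open scoped TensorProduct

noncomputable section

namespace QuantumSl2

/-! ### The base ring `ℂ⟦h⟧` and `h`-adic completions -/

/-- The ring `ℂ⟦h⟧` of formal power series in `h`; the indeterminate `h` is `PowerSeries.X`. -/
abbrev Ch : Type := PowerSeries ℂ

/-- The element `h` of `ℂ⟦h⟧`. -/
abbrev h : Ch := PowerSeries.X

section Completion

variable (A : Type) [Ring A] [Algebra Ch A]

/-- The ideal `hⁿ A` of a `ℂ⟦h⟧`-algebra `A`. -/
def hIdeal (n : ℕ) : Ideal A where
  carrier := {a | ∃ b : A, a = h ^ n • b}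
  add_mem' := by
    rintro _ _ ⟨b, rfl⟩ ⟨c, rfl⟩
    exact ⟨b + c, (smul_add _ _ _).symm⟩
  zero_mem' := ⟨0, (smul_zero _).symm⟩
  smul_mem' := by
    rintro c _ ⟨b, rfl⟩
    exact ⟨c * b, by rw [smul_eq_mul, mul_smul_comm]⟩

variable {A} in
theorem mem_hIdeal {n : ℕ} {a : A} : a ∈ hIdeal A n ↔ ∃ b : A, a = h ^ n • b := Iff.rfl

instance hIdeal_isTwoSided (n : ℕ) : (hIdeal A n).IsTwoSided where
  mul_mem_of_left := by
    rintro _ c ⟨b, rfl⟩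
    exact ⟨b * c, by rw [smul_mul_assoc]⟩

theorem hIdeal_anti {m n : ℕ} (hmn : m ≤ n) : hIdeal A n ≤ hIdeal A m := by
  rintro _ ⟨b, rfl⟩
  exact ⟨h ^ (n - m) • b, by rw [smul_smul, ← pow_add, Nat.add_sub_cancel' hmn]⟩

/-- The `h`-adic completion `lim A / hⁿ A`, as a subalgebra of `∏ A / hⁿ A`. -/
def completionSubalgebra : Subalgebra Ch (∀ n : ℕ, A ⧸ hIdeal A n) where
  carrier := {f | ∀ (m n : ℕ) (hmn : m ≤ n),
    Ideal.Quotient.factorₐ Ch (hIdeal_anti A hmn) (f n) = f m}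
  mul_mem' := by
    intro f g hf hg m n hmn
    rw [Pi.mul_apply, map_mul, hf m n hmn, hg m n hmn, Pi.mul_apply]
  add_mem' := by
    intro f g hf hg m n hmn
    rw [Pi.add_apply, map_add, hf m n hmn, hg m n hmn, Pi.add_apply]
  algebraMap_mem' := by
    intro r m n hmn
    rw [Pi.algebraMap_apply, AlgHom.commutes, Pi.algebraMap_apply]

/-- The `h`-adic completion `lim A / hⁿ A` of a `ℂ⟦h⟧`-algebra `A`. -/
def Completion : Type := completionSubalgebra A

instance : Ring (Completion A) := inferInstanceAs (Ring (completionSubalgebra A))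

instance : Algebra Ch (Completion A) := inferInstanceAs (Algebra Ch (completionSubalgebra A))

namespace Completion

/-- The projection of the completion to `A / hⁿ A`. -/
def eval (n : ℕ) : Completion A →ₐ[Ch] A ⧸ hIdeal A n :=
  (Pi.evalAlgHom Ch (fun n : ℕ => A ⧸ hIdeal A n) n).comp (completionSubalgebra A).val

/-- The canonical map from `A` to its completion. -/
def of : A →ₐ[Ch] Completion A :=
  (AlgHom.pi
    (fun n => Ideal.Quotient.mkₐ Ch (hIdeal A n))).codRestrict
    (completionSubalgebra A) (fun _ _ _ _ => rfl)

variable {A}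

@[ext]
theorem ext {f g : Completion A} (hfg : ∀ n, eval A n f = eval A n g) : f = g :=
  Subtype.ext (funext hfg)

theorem eval_of (n : ℕ) (a : A) : eval A n (of A a) = Ideal.Quotient.mk (hIdeal A n) a := rfl

theorem factor_eval {m n : ℕ} (hmn : m ≤ n) (f : Completion A) :
    Ideal.Quotient.factorₐ Ch (hIdeal_anti A hmn) (eval A n f) = eval A m f := f.2 m n hmn

/-- The sum `∑ₙ aₙ` of a series with `aₙ ∈ hⁿ A`; it is congruent to `∑_{n < m} aₙ`
modulo `hᵐ`. -/
def hSum (a : ℕ → A) (ha : ∀ n, a n ∈ hIdeal A n) : Completion A :=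
  ⟨fun m => Ideal.Quotient.mk (hIdeal A m) (∑ n ∈ Finset.range m, a n), by
    intro m n hmn
    change Ideal.Quotient.mk (hIdeal A m) _ = Ideal.Quotient.mk (hIdeal A m) _
    rw [Ideal.Quotient.eq, ← Finset.sum_sdiff_eq_sub (Finset.range_subset_range.2 hmn)]
    refine Ideal.sum_mem _ fun i hi => hIdeal_anti A ?_ (ha i)
    simpa using (Finset.mem_sdiff.1 hi).2⟩

theorem eval_hSum (a : ℕ → A) (ha : ∀ n, a n ∈ hIdeal A n) (m : ℕ) :
    eval A m (hSum a ha) = Ideal.Quotient.mk (hIdeal A m) (∑ n ∈ Finset.range m, a n) := rfl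

/-- The value `∑ₙ cₙ zⁿ` of a power series with coefficients in `ℂ⟦h⟧` at an element `z` of
`h A`. -/
def hEval (c : ℕ → Ch) (z : A) (hz : z ∈ hIdeal A 1) : Completion A :=
  hSum (fun n => c n • z ^ n) (by
    intro n
    obtain ⟨b, rfl⟩ := hz
    exact ⟨c n • b ^ n, by rw [smul_pow, pow_one, smul_comm]⟩)

/-- The usual exponential `e^z` of an element `z` of `h A`. -/
def exp (z : A) (hz : z ∈ hIdeal A 1) : Completion A :=
  hEval (fun n => PowerSeries.C ((n.factorial : ℂ)⁻¹)) z hz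

section Extension

variable {B : Type} [Ring B] [Algebra Ch B]

theorem linear_mem (f : A →ₗ[Ch] Completion B) (n : ℕ) :
    (hIdeal A n).restrictScalars Ch ≤ LinearMap.ker ((eval B n).toLinearMap ∘ₗ f) := by
  rintro _ ⟨b, rfl⟩
  rw [LinearMap.mem_ker, map_smul]
  obtain ⟨c, hc⟩ := Ideal.Quotient.mk_surjective (((eval B n).toLinearMap ∘ₗ f) b)
  rw [← hc]
  exact Ideal.Quotient.eq_zero_iff_mem.2 ⟨c, rfl⟩

/-- A `ℂ⟦h⟧`-linear map from `A` to `lim B / hⁿ B`, modulo `hⁿ`. -/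
def extendLevel (f : A →ₗ[Ch] Completion B) (n : ℕ) :
    (A ⧸ hIdeal A n) →ₗ[Ch] B ⧸ hIdeal B n :=
  Submodule.liftQ ((hIdeal A n).restrictScalars Ch) ((eval B n).toLinearMap ∘ₗ f)
      (linear_mem f n) ∘ₗ
    (Submodule.Quotient.restrictScalarsEquiv Ch (hIdeal A n)).symm.toLinearMap

theorem extendLevel_mk (f : A →ₗ[Ch] Completion B) (n : ℕ) (a : A) :
    extendLevel f n (Ideal.Quotient.mk (hIdeal A n) a) = eval B n (f a) := rfl

/-- The unique extension of a `ℂ⟦h⟧`-linear map `A → lim B / hⁿ B` to the completion of `A`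
that is compatible with the projections modulo `hⁿ`. -/
def extend (f : A →ₗ[Ch] Completion B) : Completion A →ₗ[Ch] Completion B where
  toFun x := ⟨fun n => extendLevel f n (eval A n x), by
    intro m n hmn
    obtain ⟨a, ha⟩ := Ideal.Quotient.mk_surjective (eval A n x)
    beta_reduce
    rw [← factor_eval hmn x, ← ha]
    exact factor_eval hmn (f a)⟩
  map_add' x y := by
    refine Subtype.ext (funext fun n => ?_)
    change extendLevel f n (eval A n (x + y)) = _
    rw [map_add, map_add]
    rfl
  map_smul' r x := by
    refine Subtype.ext (funext fun n => ?_)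
    change extendLevel f n (eval A n (r • x)) = _
    rw [map_smul, map_smul]
    rfl

theorem extend_of (f : A →ₗ[Ch] Completion B) (a : A) : extend f (of A a) = f a := rfl

/-- The algebra homomorphism of completions induced by an algebra homomorphism. -/
def map (f : A →ₐ[Ch] B) : Completion A →ₐ[Ch] Completion B :=
  AlgHom.ofLinearMap (extend ((of B).comp f).toLinearMap)
    (by rw [← map_one (of A), extend_of]; simp)
    (by
      intro x y
      refine ext fun n => ?_
      obtain ⟨a, ha⟩ := Ideal.Quotient.mk_surjective (eval A n x)
      obtain ⟨b, hb⟩ := Ideal.Quotient.mk_surjective (eval A n y)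
      rw [map_mul (eval B n)]
      change extendLevel ((of B).comp f).toLinearMap n (eval A n (x * y)) =
        extendLevel ((of B).comp f).toLinearMap n (eval A n x) *
          extendLevel ((of B).comp f).toLinearMap n (eval A n y)
      rw [map_mul, ← ha, ← hb, ← map_mul, extendLevel_mk, extendLevel_mk, extendLevel_mk]
      simp)

theorem map_of (f : A →ₐ[Ch] B) (a : A) : map f (of A a) = of B (f a) := rfl

end Extension

end Completion

/-! ### Topological Hopf algebras over `ℂ⟦h⟧` and universal R-matrices

The tensor products in the definition of a Hopf algebra over `ℂ⟦h⟧` are `h`-adically completed. -/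

/-- The completed tensor square of `A` over `ℂ⟦h⟧`. -/
abbrev T2 : Type := Completion (A ⊗[Ch] A)

/-- The completed tensor cube of `A` over `ℂ⟦h⟧`. -/
abbrev T3 : Type := Completion (A ⊗[Ch] (A ⊗[Ch] A))

/-- `a ⊗ b ↦ b ⊗ a`. -/
def twist : T2 A →ₐ[Ch] T2 A :=
  Completion.map (Algebra.TensorProduct.comm Ch A A).toAlgHom

/-- `a ⊗ b ↦ a ⊗ b ⊗ 1`. -/
def leg12 : T2 A →ₐ[Ch] T3 A :=
  Completion.map (Algebra.TensorProduct.map (AlgHom.id Ch A)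
    (Algebra.TensorProduct.includeLeft : A →ₐ[Ch] A ⊗[Ch] A))

/-- `a ⊗ b ↦ a ⊗ 1 ⊗ b`. -/
def leg13 : T2 A →ₐ[Ch] T3 A :=
  Completion.map (Algebra.TensorProduct.map (AlgHom.id Ch A)
    (Algebra.TensorProduct.includeRight : A →ₐ[Ch] A ⊗[Ch] A))

/-- `a ⊗ b ↦ 1 ⊗ a ⊗ b`. -/
def leg23 : T2 A →ₐ[Ch] T3 A :=
  Completion.map (Algebra.TensorProduct.includeRight : A ⊗[Ch] A →ₐ[Ch] A ⊗[Ch] (A ⊗[Ch] A))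

/-- `a ↦ a ⊗ 1 ⊗ 1`. -/
def leg1 : A →ₐ[Ch] T3 A :=
  (Completion.of (A ⊗[Ch] (A ⊗[Ch] A))).comp Algebra.TensorProduct.includeLeft

/-- `a ↦ 1 ⊗ 1 ⊗ a`. -/
def leg3 : A →ₐ[Ch] T3 A :=
  (Completion.of (A ⊗[Ch] (A ⊗[Ch] A))).comp
    ((Algebra.TensorProduct.includeRight : A ⊗[Ch] A →ₐ[Ch] A ⊗[Ch] (A ⊗[Ch] A)).comp
      Algebra.TensorProduct.includeRight)

variable {A}

/-- The continuous linear map on the completed tensor square given by `a ⊗ b ↦ f(a) g(b)`. -/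
def mulMap {B : Type} [Ring B] [Algebra Ch B] (f g : A →ₗ[Ch] Completion B) :
    T2 A →ₗ[Ch] Completion B :=
  Completion.extend (LinearMap.mul' Ch (Completion B) ∘ₗ TensorProduct.map f g)

theorem mulMap_of_tmul {B : Type} [Ring B] [Algebra Ch B] (f g : A →ₗ[Ch] Completion B)
    (a b : A) : mulMap f g (Completion.of (A ⊗[Ch] A) (a ⊗ₜ[Ch] b)) = f a * g b := rfl

/-- `D ⊗ id : a ⊗ b ↦ D(a) ⊗ b`. -/
def tensorId (D : A →ₐ[Ch] T2 A) : T2 A →ₗ[Ch] T3 A :=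
  mulMap ((leg12 A).comp D).toLinearMap (leg3 A).toLinearMap

/-- `id ⊗ D : a ⊗ b ↦ a ⊗ D(b)`. -/
def idTensor (D : A →ₐ[Ch] T2 A) : T2 A →ₗ[Ch] T3 A :=
  mulMap (leg1 A).toLinearMap ((leg23 A).comp D).toLinearMap

/-- An antihomomorphism `A → A`, as a linear map to the completion of `A`. -/
def antiToCompletion (S : A →ₐ[Ch] Aᵐᵒᵖ) : A →ₗ[Ch] Completion A :=
  (Completion.of A).toLinearMap ∘ₗ (MulOpposite.opLinearEquiv Ch).symm.toLinearMap ∘ₗ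
    S.toLinearMap

/-- A homomorphism `A → ℂ⟦h⟧` followed by the unit map, as a map to the completion of `A`. -/
def scalarToCompletion (e : A →ₐ[Ch] Ch) : A →ₗ[Ch] Completion A :=
  ((Algebra.ofId Ch (Completion A)).comp e).toLinearMap

variable (A) in
/-- The structure of a topological Hopf algebra on the `ℂ⟦h⟧`-algebra `A`. For an `h`-adically
complete `A` the canonical map `Completion.of A` from `A` to its completion is bijective;
the counit and antipode identities are stated through it. -/
@[ext]
structure HopfStructure where
  /-- The coproduct `Δ`. -/
  comul : A →ₐ[Ch] T2 A
  /-- The counit `ε`. -/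
  counit : A →ₐ[Ch] Ch
  /-- The antipode `S`, an antihomomorphism. -/
  antipode : A →ₐ[Ch] Aᵐᵒᵖ
  coassoc : ∀ a, idTensor comul (comul a) = tensorId comul (comul a)
  counit_left : ∀ a,
    mulMap (scalarToCompletion counit) (Completion.of A).toLinearMap (comul a) =
      Completion.of A a
  counit_right : ∀ a,
    mulMap (Completion.of A).toLinearMap (scalarToCompletion counit) (comul a) =
      Completion.of A a
  antipode_left : ∀ a,
    mulMap (antiToCompletion antipode) (Completion.of A).toLinearMap (comul a) =
      scalarToCompletion counit a
  antipode_right : ∀ a,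
    mulMap (Completion.of A).toLinearMap (antiToCompletion antipode) (comul a) =
      scalarToCompletion counit a

/-- `R` is a universal R-matrix for the topological Hopf algebra `A`. -/
structure IsUniversalRMatrix (𝓗 : HopfStructure A) (R : T2 A) : Prop where
  isUnit : IsUnit R
  conj : ∀ a, twist A (𝓗.comul a) = R * 𝓗.comul a * Ring.inverse R
  comul_id : tensorId 𝓗.comul R = leg13 A R * leg23 A R
  id_comul : idTensor 𝓗.comul R = leg13 A R * leg12 A R

end Completion

/-! ### Quantum numbers in `ℂ⟦h⟧` -/

/-- `qPow r` is `q ^ r = e ^ (r h / 2)`, where `q = e ^ (h / 2)`. -/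
def qPow (r : ℂ) : Ch := PowerSeries.rescale (r / 2) (PowerSeries.exp ℂ)

/-- The quotient by `h` of a power series without constant term. -/
def divh {F : Type} [Ring F] (f : PowerSeries F) : PowerSeries F :=
  PowerSeries.mk fun n => PowerSeries.coeff (n + 1) f

theorem divh_mul_X {F : Type} [Ring F] (f : PowerSeries F)
    (hf : PowerSeries.constantCoeff f = 0) : divh f * PowerSeries.X = f := by
  ext n
  cases n with
  | zero => simp [hf]
  | succ n => simp [divh, PowerSeries.coeff_succ_mul_X]

theorem qPow_sub_const (r s : ℂ) : PowerSeries.constantCoeff (qPow r - qPow s) = 0 := by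
  rw [← PowerSeries.coeff_zero_eq_constantCoeff_apply, map_sub, qPow, qPow,
    PowerSeries.coeff_rescale, PowerSeries.coeff_rescale, pow_zero, pow_zero, sub_self]

/-- `q - q⁻¹`. -/
def qDiff : Ch := qPow 1 - qPow (-1)

theorem qDiff_eq : qDiff = h * divh qDiff := by
  rw [mul_comm]
  exact (divh_mul_X _ (qPow_sub_const _ _)).symm

/-- The quantum integer `[n] = (qⁿ - q⁻ⁿ) / (q - q⁻¹)`; numerator and denominator are first
divided by `h`, which makes the denominator invertible in `ℂ⟦h⟧`. -/
def qInt (n : ℕ) : Ch := divh (qPow n - qPow (-n)) * (divh qDiff)⁻¹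

/-- The quantum factorial `[n]!`, an invertible element of `ℂ⟦h⟧`. -/
def qFact (n : ℕ) : Ch := ∏ i ∈ Finset.range n, qInt (i + 1)

/-- The quantum exponential function `Exp_q(z) = ∑ₙ q^{n(n-1)/2} / [n]! zⁿ` on `h A`. -/
def qExp {A : Type} [Ring A] [Algebra Ch A] (z : A) (hz : z ∈ hIdeal A 1) : Completion A :=
  Completion.hEval (fun n => qPow (n * (n - 1) / 2) * (qFact n)⁻¹) z hz

/-! ### The quantized universal enveloping algebra of `sl₂` -/

/-- The three generators. -/
inductive Gen : Type
  | x
  | y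
  | H

/-- The free associative algebra on the generators. -/
abbrev FreeAlg : Type := FreeAlgebra ℂ Gen

/-- A generator as a constant power series over the free algebra. -/
def gen (g : Gen) : PowerSeries FreeAlg := PowerSeries.C (FreeAlgebra.ι ℂ g)

/-- The inclusion of `ℂ⟦h⟧` in the power series over the free algebra. -/
def scalar : Ch →+* PowerSeries FreeAlg := PowerSeries.map (algebraMap ℂ FreeAlg)

theorem scalar_comm (c : Ch) (f : PowerSeries FreeAlg) : scalar c * f = f * scalar c := by
  ext n
  rw [PowerSeries.coeff_mul, PowerSeries.coeff_mul]
  refine (Finset.sum_congr rfl fun i _ => ?_).trans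
    (Finset.Nat.sum_antidiagonal_swap
      (f := fun p : ℕ × ℕ => PowerSeries.coeff p.1 f * PowerSeries.coeff p.2 (scalar c)))
  simp [scalar, Algebra.commutes]

/-- `e ^ (c h H)` as a power series over the free algebra. -/
def freeExpH (c : ℂ) : PowerSeries FreeAlg :=
  PowerSeries.mk fun n => (c ^ n / (n.factorial : ℂ)) • FreeAlgebra.ι ℂ Gen.H ^ n

/-- `[H] = (e^{hH/2} - e^{-hH/2}) / (e^{h/2} - e^{-h/2})`; numerator and denominator are first
divided by `h`, which makes the denominator invertible in `ℂ⟦h⟧`. -/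
def freeBracketH : PowerSeries FreeAlg :=
  scalar (divh qDiff)⁻¹ * divh (freeExpH (1 / 2) - freeExpH (-1 / 2))

/-- The defining relations `Hx - xH = 2x`, `Hy - yH = -2y`, `xy - yx = [H]`, each written as an
element that is to vanish. -/
def relators : Set (PowerSeries FreeAlg) :=
  {gen .H * gen .x - gen .x * gen .H - 2 * gen .x,
   gen .H * gen .y - gen .y * gen .H + 2 * gen .y,
   gen .x * gen .y - gen .y * gen .x - freeBracketH}

/-- The closure, in the `h`-adic topology, of the two-sided ideal generated by the relators. -/
def relIdeal : TwoSidedIdeal (PowerSeries FreeAlg) :=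
  ⨅ n : ℕ, TwoSidedIdeal.span relators ⊔ TwoSidedIdeal.span {PowerSeries.X ^ n}

/-- The quantized universal enveloping algebra `U_h(sl₂)`: the `ℂ⟦h⟧`-algebra topologically
generated by `x`, `y`, `H` subject to the defining relations. -/
def Uh : Type := relIdeal.ringCon.Quotient

instance : Ring Uh := inferInstanceAs (Ring relIdeal.ringCon.Quotient)

namespace Uh

/-- The quotient map onto `U_h(sl₂)`. -/
def mk : PowerSeries FreeAlg →+* Uh := relIdeal.ringCon.mk'

theorem mk_surjective : Function.Surjective mk := relIdeal.ringCon.mk'_surjective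

instance : Algebra Ch Uh :=
  (mk.comp scalar).toAlgebra' (by
    intro c u
    obtain ⟨f, rfl⟩ := mk_surjective u
    rw [RingHom.comp_apply, ← map_mul, ← map_mul, scalar_comm])

/-- The generator `x`. -/
def x : Uh := mk (gen .x)

/-- The generator `y`. -/
def y : Uh := mk (gen .y)

/-- The generator `H`. -/
def H : Uh := mk (gen .H)

/-- `k = e^{hH/4}`. -/
def k : Uh := mk (freeExpH (1 / 4))

/-- `k⁻¹ = e^{-hH/4}`. -/
def kInv : Uh := mk (freeExpH (-1 / 4))

/-- The values of the coproduct, counit and antipode of `U_h(sl₂)` on the generators. -/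
structure HasStandardValues (𝓗 : HopfStructure Uh) : Prop where
  comul_x : 𝓗.comul x = Completion.of (Uh ⊗[Ch] Uh) (x ⊗ₜ[Ch] k + kInv ⊗ₜ[Ch] x)
  comul_y : 𝓗.comul y = Completion.of (Uh ⊗[Ch] Uh) (y ⊗ₜ[Ch] k + kInv ⊗ₜ[Ch] y)
  comul_H : 𝓗.comul H = Completion.of (Uh ⊗[Ch] Uh) (H ⊗ₜ[Ch] 1 + 1 ⊗ₜ[Ch] H)
  counit_x : 𝓗.counit x = 0
  counit_y : 𝓗.counit y = 0
  counit_H : 𝓗.counit H = 0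
  antipode_x : (𝓗.antipode x).unop = -(qPow 1 • x)
  antipode_y : (𝓗.antipode y).unop = -(qPow (-1) • y)
  antipode_H : (𝓗.antipode H).unop = -H

/-- `(h/4) H ⊗ H`. -/
def cartan : Uh ⊗[Ch] Uh := (h * PowerSeries.C (1 / 4 : ℂ)) • (H ⊗ₜ[Ch] H)

theorem cartan_mem : cartan ∈ hIdeal (Uh ⊗[Ch] Uh) 1 :=
  ⟨PowerSeries.C (1 / 4 : ℂ) • (H ⊗ₜ[Ch] H), by rw [cartan, smul_smul, pow_one]⟩

/-- The term `(q - q⁻¹)ⁿ / [n]! q^{n(n-3)/2} (k x)ⁿ ⊗ (k⁻¹ y)ⁿ`. -/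
def rTerm (n : ℕ) : Uh ⊗[Ch] Uh :=
  (qDiff ^ n * (qFact n)⁻¹ * qPow (n * (n - 3) / 2)) •
    (((k * x) ^ n) ⊗ₜ[Ch] ((kInv * y) ^ n))

theorem rTerm_mem (n : ℕ) : rTerm n ∈ hIdeal (Uh ⊗[Ch] Uh) n :=
  ⟨(divh qDiff ^ n * (qFact n)⁻¹ * qPow (n * (n - 3) / 2)) •
    (((k * x) ^ n) ⊗ₜ[Ch] ((kInv * y) ^ n)), by
    rw [rTerm, smul_smul, qDiff_eq, mul_pow, ← qDiff_eq, mul_assoc, mul_assoc, mul_assoc]⟩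

/-- The element `R = e^{(h/4) H ⊗ H} ∑ₙ (q - q⁻¹)ⁿ / [n]! q^{n(n-3)/2} (k x)ⁿ ⊗ (k⁻¹ y)ⁿ`. -/
def R : T2 Uh := Completion.exp cartan cartan_mem * Completion.hSum rTerm rTerm_mem

/-- `λ_q k x ⊗ k⁻¹ y`, where `λ_q = q⁻¹ (q - q⁻¹)`. -/
def nilp : Uh ⊗[Ch] Uh := (qPow (-1) * qDiff) • ((k * x) ⊗ₜ[Ch] (kInv * y))

theorem nilp_mem : nilp ∈ hIdeal (Uh ⊗[Ch] Uh) 1 :=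
  ⟨(qPow (-1) * divh qDiff) • ((k * x) ⊗ₜ[Ch] (kInv * y)), by
    rw [nilp, smul_smul, pow_one, mul_left_comm, ← qDiff_eq]⟩

end Uh

/-! ### The quotients above are genuine quotients -/

section Quotients

open PowerSeries

theorem divDiff_const (r : ℂ) : constantCoeff (divh (qPow r - qPow (-r))) = r := by
  rw [← coeff_zero_eq_constantCoeff_apply, divh, coeff_mk, map_sub, qPow, qPow, coeff_rescale, coeff_rescale]
  simp [coeff_exp]
  ring

theorem divqDiff_const : constantCoeff (divh qDiff) = 1 := divDiff_const 1

theorem qInt_const (n : ℕ) : constantCoeff (qInt n) = n := by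
  rw [qInt, map_mul, constantCoeff_inv, divDiff_const, divqDiff_const]; simp

theorem qInt_mul (n : ℕ) : qInt n * qDiff = qPow n - qPow (-n) := by
  conv_lhs => rw [qDiff_eq]
  rw [qInt, mul_comm h, ← mul_assoc, mul_assoc _ _ (divh qDiff), PowerSeries.inv_mul_cancel _ (by rw [divqDiff_const]; simp), mul_one, divh_mul_X _ (qPow_sub_const _ _)]

theorem qFact_const (n : ℕ) : constantCoeff (qFact n) = n.factorial := by
  rw [qFact, map_prod, ← Finset.prod_range_add_one_eq_factorial]; push_cast; simp [qInt_const]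

theorem bracket_mul : scalar qDiff * freeBracketH = freeExpH (1/2) - freeExpH (-1/2) := by
  conv_lhs => rw [qDiff_eq]
  rw [freeBracketH, ← mul_assoc, ← map_mul, mul_assoc, PowerSeries.mul_inv_cancel _ (by rw [divqDiff_const]; simp), mul_one, scalar_comm]
  have : scalar h = X := by simp [scalar, h]
  rw [this, divh_mul_X]
  rw [← coeff_zero_eq_constantCoeff_apply]; simp [freeExpH]

theorem freeExpH_mul (a b : ℂ) : freeExpH a * freeExpH b = freeExpH (a+b) := by
  ext n
  rw [coeff_mul]
  simp only [freeExpH, coeff_mk]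
  simp only [smul_mul_smul_comm, ← pow_add]
  rw [Finset.sum_congr rfl (g := fun p : ℕ × ℕ => ((a ^ p.1 / (p.1.factorial : ℂ)) * (b ^ p.2 / (p.2.factorial : ℂ))) • FreeAlgebra.ι ℂ Gen.H ^ n) (fun p hp => by rw [Finset.HasAntidiagonal.mem_antidiagonal.1 hp]), ← Finset.sum_smul]
  congr 1
  rw [add_pow, Finset.Nat.sum_antidiagonal_eq_sum_range_succ_mk, Finset.sum_div]
  refine Finset.sum_congr rfl fun i hi => ?_
  rw [Nat.cast_choose ℂ (by simpa [Nat.lt_succ_iff] using hi)]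
  have := Nat.factorial_ne_zero n
  field_simp

theorem k_mul_kInv : Uh.k * Uh.kInv = 1 := by
  rw [Uh.k, Uh.kInv, ← map_mul, freeExpH_mul]
  have : freeExpH (1/4 + -1/4) = 1 := by
    ext n; rw [show (1/4 + -1/4 : ℂ) = 0 by norm_num]; cases n <;> simp [freeExpH, coeff_one]
  rw [this, map_one]

end Quotients

end QuantumSl2

end

open QuantumSl2

noncomputable section

namespace QuantumSl2

open PowerSeries Finset

/-! ### Complete `ℂ⟦h⟧`-algebras and evaluation of power series at `h` -/

/-! Over `ℂ⟦h⟧`, linear maps are automatically `h`-adically continuous. Hence a homomorphism from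
`U` to a separated complete algebra is determined by its values on `x`, `y`, `H` (`Uh.algHom_ext`),
and any triple satisfying the three relations in such an algebra extends to `U` (`Uh.lift`).
Completions and opposites of complete algebras are again complete, so `Δ`, `ε`, `S` exist once the
relations are checked on their prescribed values, and they are unique. Coassociativity and the
counit axioms compare homomorphisms, hence hold because they hold on generators. In the antipode
axioms one side is not visibly multiplicative, and closure under products needs a separate argument
(`mulMap_anti_left_mul`, `mulMap_anti_right_mul`).

For the R-matrix, put `C = e^{(h/4) H⊗H}`, `N = λ_q kx ⊗ k⁻¹y`, `E = Exp_q(N)`. Since `n(n-3)/2 =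
n(n-1)/2 - n`, one has `R = C E`. Three facts carry the proof.

(1) The coefficients of `Exp_q` are the inverse Gaussian factorials for `p = q⁻²`, so `ba = p ab`
implies `Exp_q(a+b) = Exp_q(a) Exp_q(b)` (`hser_add`).

(2) Conjugation by `C` multiplies `x` in one leg by `k²` in the other, and `y` by `k⁻²` (the lemmas
`cartanExp_x_right`, `cartanExp_y_right` and their mirror images).

(3) If `[P, N] = S - T`, `SN = p NS` and `NT = p TN`, then `E (P + S) = (P + T) E`
(`hser_intertwine`).

For `(Δ⊗id)(R)`, `N` goes to a sum `a + b` with `ba = p ab` and `C` to `C₁₃C₂₃`; by (1) the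
exponential splits, and by (2) moving `C₂₃` past `Exp_q(a)` leaves `R₁₃R₂₃`. The identity for `id⊗Δ`
is symmetric. For quasi-cocommutativity on `x` and `y`, (3) replaces one summand of the coproduct
and (2) turns the result into the opposite coproduct; on `H` both factors of `R` commute with the
coproduct. -/

/-- A `ℂ⟦h⟧`-algebra that is separated and complete in the `h`-adic topology. -/
class HComplete (B : Type) [Ring B] [Algebra Ch B] : Prop where
  sep : ∀ b : B, (∀ n, b ∈ hIdeal B n) → b = 0
  prec : ∀ a : ℕ → B, ∃ s : B, ∀ n, s - ∑ i ∈ range n, h ^ i • a i ∈ hIdeal B n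

section HIdeal

variable {A B : Type} [Ring A] [Algebra Ch A] [Ring B] [Algebra Ch B]

theorem pow_smul_mem_hIdeal (n : ℕ) (b : B) : h ^ n • b ∈ hIdeal B n := ⟨b, rfl⟩

theorem mem_hIdeal_zero (b : B) : b ∈ hIdeal B 0 := ⟨b, by simp⟩

theorem h_smul_mem_hIdeal {n : ℕ} {b : B} (hb : b ∈ hIdeal B n) : h • b ∈ hIdeal B (n + 1) := by
  obtain ⟨c, rfl⟩ := hb
  exact ⟨c, by rw [smul_smul, pow_succ']⟩

theorem map_mem_hIdeal (f : A →ₗ[Ch] B) {n : ℕ} {a : A} (ha : a ∈ hIdeal A n) :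
    f a ∈ hIdeal B n := by
  obtain ⟨c, rfl⟩ := ha
  exact ⟨f c, map_smul _ _ _⟩

theorem smul_mem_hIdeal (r : Ch) {n : ℕ} {b : B} (hb : b ∈ hIdeal B n) :
    r • b ∈ hIdeal B n := by
  obtain ⟨c, rfl⟩ := hb
  exact ⟨r • c, smul_comm _ _ _⟩

/-- A family of additive defects that is divided by `h` at each step vanishes. -/
theorem eq_zero_of_forall_eq_h_smul [HComplete B] {ι : Type} (d : ι → B)
    (hd : ∀ i, ∃ j, d i = h • d j) (i : ι) : d i = 0 := by
  refine HComplete.sep _ fun n => ?_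
  induction n generalizing i with
  | zero => exact mem_hIdeal_zero _
  | succ n ih =>
    obtain ⟨j, hj⟩ := hd i
    rw [hj]
    exact h_smul_mem_hIdeal (ih j)

end HIdeal

section EvalPS

variable {A B : Type} [Ring A] [Algebra Ch A] [HComplete A] [Ring B] [Algebra Ch B] [HComplete B]

/-- The sum `∑ hⁿ bₙ` of the values of a power series over `B` at `h`. -/
def evalFun (f : PowerSeries B) : B :=
  Classical.choose (HComplete.prec fun n => coeff n f)

theorem evalFun_spec (f : PowerSeries B) (n : ℕ) :
    evalFun f - ∑ i ∈ range n, h ^ i • coeff i f ∈ hIdeal B n :=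
  Classical.choose_spec (HComplete.prec fun n => coeff n f) n

theorem eq_evalFun {s : B} {f : PowerSeries B}
    (hs : ∀ n, s - ∑ i ∈ range n, h ^ i • coeff i f ∈ hIdeal B n) : s = evalFun f := by
  refine sub_eq_zero.1 (HComplete.sep _ fun n => ?_)
  have := Ideal.sub_mem _ (hs n) (evalFun_spec f n)
  rwa [sub_sub_sub_cancel_right] at this

theorem evalFun_add (f g : PowerSeries B) : evalFun (f + g) = evalFun f + evalFun g := by
  refine (eq_evalFun fun n => ?_).symm
  have := Ideal.add_mem _ (evalFun_spec f n) (evalFun_spec g n)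
  simpa only [map_add, smul_add, sum_add_distrib, add_sub_add_comm] using this

theorem evalFun_C_mul (a : B) (g : PowerSeries B) : evalFun (C a * g) = a * evalFun g := by
  refine (eq_evalFun fun n => ?_).symm
  have := Ideal.mul_mem_left _ a (evalFun_spec g n)
  simpa only [coeff_C_mul, mul_sub, mul_sum, mul_smul_comm] using this

theorem evalFun_X_mul (g : PowerSeries B) : evalFun (X * g) = h • evalFun g := by
  refine (eq_evalFun fun n => ?_).symm
  cases n with
  | zero => exact mem_hIdeal_zero _
  | succ n =>
    have := h_smul_mem_hIdeal (evalFun_spec g n)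
    rw [sum_range_succ']
    simpa only [smul_sub, smul_sum, smul_smul, coeff_succ_X_mul, ← pow_succ', coeff_zero_X_mul,
      smul_zero, add_zero] using this

theorem evalFun_C (a : B) : evalFun (C a) = a := by
  refine (eq_evalFun fun n => ?_).symm
  cases n with
  | zero => exact mem_hIdeal_zero _
  | succ n => rw [sum_range_succ']; simp [coeff_C]

/-- Splitting `f` into its constant term and `X` times its shift makes the defect at `f` equal to
`h` times the defect at the shift, so separatedness kills it and no Cauchy product is needed. -/
theorem evalFun_mul (f g : PowerSeries B) : evalFun (f * g) = evalFun f * evalFun g := by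
  rw [← sub_eq_zero]
  refine eq_zero_of_forall_eq_h_smul (fun f => evalFun (f * g) - evalFun f * evalFun g)
    (fun f => ⟨mk fun p => coeff (p + 1) f, ?_⟩) f
  conv_lhs => rw [eq_X_mul_shift_add_const f]
  rw [add_mul, evalFun_add, evalFun_add, evalFun_C_mul, evalFun_C, mul_assoc, evalFun_X_mul,
    evalFun_X_mul, add_mul, smul_sub, smul_mul_assoc]
  abel

variable (B) in
/-- Evaluation of power series over a complete algebra at `h`. -/
def evalPS : PowerSeries B →+* B where
  toFun := evalFun
  map_one' := by rw [← map_one (C (R := B)), evalFun_C]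
  map_mul' := evalFun_mul
  map_zero' := by rw [← map_zero (C (R := B)), evalFun_C]
  map_add' := evalFun_add

theorem evalPS_spec (f : PowerSeries B) (n : ℕ) :
    evalPS B f - ∑ i ∈ range n, h ^ i • coeff i f ∈ hIdeal B n := evalFun_spec f n

theorem eq_evalPS {s : B} {f : PowerSeries B}
    (hs : ∀ n, s - ∑ i ∈ range n, h ^ i • coeff i f ∈ hIdeal B n) : s = evalPS B f :=
  eq_evalFun hs

@[simp] theorem evalPS_C (a : B) : evalPS B (C a) = a := evalFun_C a

theorem evalPS_X_mul (f : PowerSeries B) : evalPS B (X * f) = h • evalPS B f := evalFun_X_mul f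

theorem evalPS_X : evalPS B X = h • 1 := by rw [← mul_one X, evalPS_X_mul, map_one]

/-- A linear map between complete algebras is continuous. -/
theorem map_evalPS_linear (φ : A →ₗ[Ch] B) (f : PowerSeries A) (g : PowerSeries B)
    (hg : ∀ n, coeff n g = φ (coeff n f)) : φ (evalPS A f) = evalPS B g := by
  refine eq_evalPS fun n => ?_
  have := map_mem_hIdeal φ (evalPS_spec f n)
  simpa only [map_sub, map_sum, map_smul, ← hg] using this

theorem evalPS_mk_h_smul (a : ℕ → B) :
    evalPS B (mk fun n => h • a n) = h • evalPS B (mk a) := by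
  refine (eq_evalPS fun n => ?_).symm
  have := smul_mem_hIdeal h (evalPS_spec (mk a) n)
  simpa only [coeff_mk, smul_sub, smul_sum, smul_smul, mul_comm h] using this

end EvalPS

/-! ### Examples of complete algebras -/

instance : HComplete Ch where
  sep b hb := by
    ext n
    obtain ⟨c, rfl⟩ := hb (n + 1)
    rw [smul_eq_mul, h, coeff_X_pow_mul', if_neg (by omega), map_zero]
  prec a := by
    -- The factor `hⁱ` shifts `a i` by `i`, so only `a 0, …, a m` reach the coefficient of index
    -- `m`.
    refine ⟨mk fun m => ∑ i ∈ range (m + 1), coeff (m - i) (a i), fun n => ?_⟩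
    obtain ⟨c, hc⟩ : X ^ n ∣ (PowerSeries.mk (fun m => ∑ i ∈ range (m + 1), coeff (m - i) (a i)) -
        ∑ i ∈ range n, h ^ i • a i : Ch) := by
      refine X_pow_dvd_iff.2 fun m hm => ?_
      rw [map_sub, coeff_mk, map_sum, sub_eq_zero]
      simp only [smul_eq_mul, h, coeff_X_pow_mul']
      rw [← sum_subset (range_subset_range.2 hm)]
      · refine sum_congr rfl fun i hi => (if_pos ?_).symm
        simpa [Nat.lt_succ_iff] using hi
      · intro i _ hi
        exact if_neg (by simpa using hi)
    exact ⟨c, hc⟩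

instance {B : Type} [Ring B] [Algebra Ch B] [HComplete B] : HComplete Bᵐᵒᵖ where
  sep b hb := by
    refine MulOpposite.unop_injective (HComplete.sep _ fun n => ?_)
    obtain ⟨c, rfl⟩ := hb n
    exact ⟨c.unop, rfl⟩
  prec a := by
    obtain ⟨s, hs⟩ := HComplete.prec fun n => (a n).unop
    refine ⟨MulOpposite.op s, fun n => ?_⟩
    obtain ⟨c, hc⟩ := hs n
    refine ⟨MulOpposite.op c, MulOpposite.unop_injective ?_⟩
    simpa using hc

namespace Completion

variable {A : Type} [Ring A] [Algebra Ch A]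

/-- The element of the completion given by a compatible sequence. -/
def ofSeq (f : ∀ n, A ⧸ hIdeal A n)
    (hf : ∀ m n (hmn : m ≤ n), Ideal.Quotient.factorₐ Ch (hIdeal_anti A hmn) (f n) = f m) :
    Completion A := ⟨f, hf⟩

theorem eval_ofSeq (f : ∀ n, A ⧸ hIdeal A n)
    (hf : ∀ m n (hmn : m ≤ n), Ideal.Quotient.factorₐ Ch (hIdeal_anti A hmn) (f n) = f m)
    (n : ℕ) : eval A n (ofSeq f hf) = f n := rfl

theorem eval_mem_hIdeal {n : ℕ} {t : Completion A} (ht : t ∈ hIdeal (Completion A) n) :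
    eval A n t = 0 := by
  obtain ⟨c, rfl⟩ := ht
  obtain ⟨a, ha⟩ := Ideal.Quotient.mk_surjective (eval A n c)
  rw [map_smul, ← ha]
  exact Ideal.Quotient.eq_zero_iff_mem.2 ⟨a, rfl⟩

/-- Every element of the completion is the sum of a series. -/
theorem exists_eval_eq_sum (t : Completion A) (n : ℕ) (ht : eval A n t = 0) :
    ∃ c : ℕ → A, ∀ m, eval A (n + m) t =
      Ideal.Quotient.mk (hIdeal A (n + m)) (∑ i ∈ range m, h ^ (n + i) • c i) := by
  -- A representative modulo `hᵐ` can be corrected by a multiple of `hᵐ` to one modulo `hᵐ⁺¹`.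
  have step : ∀ (m : ℕ) (a : A), eval A m t = Ideal.Quotient.mk (hIdeal A m) a →
      ∃ c : A, eval A (m + 1) t = Ideal.Quotient.mk (hIdeal A (m + 1)) (a + h ^ m • c) := by
    intro m a ha
    obtain ⟨b, hb⟩ := Ideal.Quotient.mk_surjective (eval A (m + 1) t)
    have h1 := factor_eval (Nat.le_succ m) t
    rw [← hb, ha] at h1
    obtain ⟨c, hc⟩ := Ideal.Quotient.eq.1 h1
    exact ⟨c, by rw [← hb, ← hc, add_sub_cancel]⟩
  choose! c hc using step
  -- Successive representatives; the start `0` is allowed because `t` vanishes modulo `hⁿ`.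
  let a : ℕ → A := fun m => Nat.rec 0 (fun m a => a + h ^ (n + m) • c (n + m) a) m
  have ha : ∀ m, a m = ∑ i ∈ range m, h ^ (n + i) • c (n + i) (a i) := by
    intro m
    induction m with
    | zero => rfl
    | succ m ih => rw [sum_range_succ, ← ih]
  refine ⟨fun i => c (n + i) (a i), fun m => ?_⟩
  rw [← ha]
  induction m with
  | zero => simpa [a] using ht
  | succ m ih => exact hc _ _ ih

/-- An element vanishing modulo `hⁿ` is a series beginning in degree `n`, from which `hⁿ` can be
factored out. Thus the inverse limit topology of the completion is its own `h`-adic topology. -/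
theorem mem_hIdeal_iff {n : ℕ} {t : Completion A} :
    t ∈ hIdeal (Completion A) n ↔ eval A n t = 0 := by
  refine ⟨eval_mem_hIdeal, fun ht => ?_⟩
  obtain ⟨c, hc⟩ := exists_eval_eq_sum t n ht
  refine ⟨hSum (fun i => h ^ i • c i) fun i => pow_smul_mem_hIdeal i _, ext fun m => ?_⟩
  rw [map_smul, eval_hSum, ← factor_eval (Nat.le_add_left m n) t, hc m]
  change Ideal.Quotient.mk (hIdeal A m) _ = Ideal.Quotient.mk (hIdeal A m) (h ^ n • _)
  simp only [smul_sum, smul_smul, pow_add]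

instance : HComplete (Completion A) where
  sep b hb := ext fun n => by rw [eval_mem_hIdeal (hb n), map_zero]
  prec a := by
    -- Modulo `hᵐ` the partial sums are constant from index `m` on, so they form a compatible
    -- sequence.
    have key : ∀ m n, m ≤ n → eval A m (∑ i ∈ range n, h ^ i • a i) =
        eval A m (∑ i ∈ range m, h ^ i • a i) := by
      intro m n hmn
      rw [← sub_eq_zero, ← map_sub, ← sum_sdiff_eq_sub (range_subset_range.2 hmn)]
      refine eval_mem_hIdeal (Ideal.sum_mem _ fun i hi => ?_)
      exact hIdeal_anti _ (by simpa using (mem_sdiff.1 hi).2) (pow_smul_mem_hIdeal i _)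
    refine ⟨ofSeq (fun n => eval A n (∑ i ∈ range n, h ^ i • a i))
      fun m n hmn => (factor_eval hmn _).trans (key m n hmn), fun n => ?_⟩
    rw [mem_hIdeal_iff, map_sub, sub_eq_zero, eval_ofSeq]

theorem exists_of_add (t : Completion A) : ∃ a t', t = of A a + h • t' := by
  obtain ⟨a, ha⟩ := Ideal.Quotient.mk_surjective (eval A 1 t)
  obtain ⟨t', ht'⟩ : t - of A a ∈ hIdeal (Completion A) 1 := by
    rw [mem_hIdeal_iff, map_sub, eval_of, ha, sub_self]
  exact ⟨a, t', by rw [← pow_one h, ← ht', add_sub_cancel]⟩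

/-- The image of `A` is dense: with `t = of a + h t'`, the difference of the two maps at `t` is `h`
times their difference at `t'`. -/
theorem linearMap_ext {B : Type} [Ring B] [Algebra Ch B] [HComplete B]
    {f g : Completion A →ₗ[Ch] B} (hfg : ∀ a, f (of A a) = g (of A a)) : f = g := by
  ext t
  rw [← sub_eq_zero]
  refine eq_zero_of_forall_eq_h_smul (fun t => f t - g t) (fun t => ?_) t
  obtain ⟨a, t', rfl⟩ := exists_of_add t
  refine ⟨t', ?_⟩
  simp only [map_add, map_smul, hfg, smul_sub]
  abel

/-- `hSum` as the sum of a convergent series. -/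
theorem hSum_eq_evalPS (a : ℕ → A) (ha : ∀ n, a n ∈ hIdeal A n) (f : PowerSeries (Completion A))
    (hf : ∀ n, of A (a n) = h ^ n • coeff n f) : hSum a ha = evalPS _ f := by
  refine eq_evalPS fun n => ?_
  rw [mem_hIdeal_iff, map_sub, eval_hSum, sub_eq_zero, ← eval_of, map_sum]
  simp only [hf]

section MulHom

variable {B : Type} [Ring B] [Algebra Ch B]

/-- The extension of an algebra homomorphism to the completion. -/
def extendHom (f : A →ₐ[Ch] Completion B) : Completion A →ₐ[Ch] Completion B :=
  AlgHom.ofLinearMap (extend f.toLinearMap) (by rw [← map_one (of A), extend_of]; simp) (by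
    intro s t
    let E := extend f.toLinearMap
    have hE : ∀ a, E (of A a) = f a := extend_of _
    -- Multiplicativity is extended by density one argument at a time: first in the right factor,
    -- then in the left.
    have h1 : ∀ a, E ∘ₗ LinearMap.mulLeft Ch (of A a) = LinearMap.mulLeft Ch (f a) ∘ₗ E :=
      fun a => linearMap_ext fun b => by
        simp only [LinearMap.comp_apply, LinearMap.mulLeft_apply, ← map_mul, hE]
    have h2 : E ∘ₗ LinearMap.mulRight Ch t = LinearMap.mulRight Ch (E t) ∘ₗ E :=
      linearMap_ext fun a => by
        simpa [hE] using LinearMap.congr_fun (h1 a) t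
    exact LinearMap.congr_fun h2 s)

theorem extendHom_of (f : A →ₐ[Ch] Completion B) (a : A) : extendHom f (of A a) = f a := rfl

end MulHom

end Completion

/-! ### Exponential series -/

section Series

variable {A B : Type} [Ring A] [Algebra Ch A] [Ring B] [Algebra Ch B]

/-- The power series `∑ cₙ zⁿ Xⁿ`. -/
def serPS (c : ℕ → Ch) (z : B) : PowerSeries B := PowerSeries.mk fun n => c n • z ^ n

theorem coeff_serPS (c : ℕ → Ch) (z : B) (n : ℕ) : coeff n (serPS c z) = c n • z ^ n :=
  coeff_mk _ _

theorem serPS_mul_C (c : ℕ → Ch) {z w a : B} (hza : z * a = a * w) :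
    serPS c z * C a = C a * serPS c w := by
  ext n
  have : SemiconjBy a w z := hza.symm
  rw [coeff_mul_C, coeff_C_mul, coeff_serPS, coeff_serPS, smul_mul_assoc, mul_smul_comm,
    (this.pow_right n).eq]

/-- The sequence `cₙ = 1 / [n]_p!` where `[n]_p = 1 + p + ⋯ + pⁿ⁻¹`. -/
structure IsGauss (p : Ch) (c : ℕ → Ch) : Prop where
  zero : c 0 = 1
  succ : ∀ n, c (n + 1) * ∑ i ∈ range (n + 1), p ^ i = c n

namespace IsGauss

variable {p : Ch} {c : ℕ → Ch} (hc : IsGauss p c)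
include hc

/-- A factorization of the unit `c n` makes both `c (n + 1)` and the next Gauss number units; this
allows Gauss numbers to be cancelled later on. -/
theorem isUnit (n : ℕ) : IsUnit (c n) ∧ IsUnit (∑ i ∈ range (n + 1), p ^ i) := by
  induction n with
  | zero => rw [hc.zero]; simp
  | succ n ih =>
    have h1 : IsUnit (c (n + 1)) := isUnit_of_mul_isUnit_left (y := ∑ i ∈ range (n + 1), p ^ i)
      (by rw [hc.succ]; exact ih.1)
    exact ⟨h1, isUnit_of_mul_isUnit_right (x := c (n + 2)) (by rw [hc.succ]; exact h1)⟩

end IsGauss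

theorem mul_pow_of_mul_eq_smul {p : Ch} {a b : B} (hba : b * a = p • (a * b)) (n : ℕ) :
    b * a ^ n = p ^ n • (a ^ n * b) := by
  induction n with
  | zero => simp
  | succ n ih =>
    rw [pow_succ, ← mul_assoc, ih, smul_mul_assoc, mul_assoc, hba, mul_smul_comm, smul_smul,
      ← pow_succ, mul_assoc]

/-- The addition theorem for the `p`-exponential. Multiplying the coefficient of degree `n + 1` of
the product by `[n+1]_p` gives `a + b` times the coefficient of degree `n`, because `[i+j] = [i] +
pⁱ[j]`. -/
theorem serPS_add {p : Ch} {c : ℕ → Ch} (hc : IsGauss p c) {a b : B} (hba : b * a = p • (a * b)) :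
    serPS c (a + b) = serPS c a * serPS c b := by
  ext n
  simp only [coeff_mul, coeff_serPS]
  induction n with
  | zero => simp [hc.zero]
  | succ n ih =>
    have hu := (hc.isUnit n).2
    set G : ℕ → Ch := fun n => ∑ i ∈ range n, p ^ i with hG
    have hcG : ∀ m, c (m + 1) * G (m + 1) = c m := hc.succ
    set T : ℕ × ℕ → B := fun x => c x.1 • a ^ x.1 * c x.2 • b ^ x.2 with hT
    have key : G (n + 1) • ∑ x ∈ antidiagonal (n + 1), T x = (a + b) * ∑ x ∈ antidiagonal n,
    T x := by
      have e1 : a * ∑ x ∈ antidiagonal n, T x = ∑ x ∈ antidiagonal (n + 1), G x.1 • T x := by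
        rw [Nat.sum_antidiagonal_succ, mul_sum]
        simp only [hG, range_zero, sum_empty, zero_smul, zero_add]
        refine sum_congr rfl fun x _ => ?_
        simp only [hT]
        rw [← hcG x.1, pow_succ']
        simp only [smul_mul_assoc, mul_smul_comm, smul_smul, mul_assoc]
        congr 1
        simp only [hG]
        ring
      -- Moving `b` past `aⁱ` costs `pⁱ`; the missing boundary term is harmless since `[0]_p = 0`.
      have e2 : b * ∑ x ∈ antidiagonal n, T x =
          ∑ x ∈ antidiagonal (n + 1), (p ^ x.1 * G x.2) • T x := by
        rw [Nat.sum_antidiagonal_succ', mul_sum]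
        simp only [hG, range_zero, sum_empty, zero_smul, mul_zero, zero_add]
        refine sum_congr rfl fun x _ => ?_
        simp only [hT]
        rw [← hcG x.2]
        simp only [smul_mul_assoc, mul_smul_comm, smul_smul]
        rw [← mul_assoc b, mul_pow_of_mul_eq_smul hba, smul_mul_assoc, mul_assoc _ b, ← pow_succ',
          smul_smul]
        congr 1
        simp only [hG]
        ring
      rw [add_mul, e1, e2, ← sum_add_distrib, smul_sum]
      refine sum_congr rfl fun x hx => ?_
      rw [← add_smul, ← mem_antidiagonal.1 hx]
      congr 1
      simp only [hG, sum_range_add, pow_add, mul_sum]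
    rw [← ih, mul_smul_comm, ← pow_succ', ← hcG n, mul_comm (c _), mul_smul] at key
    exact (hu.smul_left_cancel.1 key).symm

end Series

section HSer

variable {A B : Type} [Ring A] [Algebra Ch A] [HComplete A] [Ring B] [Algebra Ch B] [HComplete B]

/-- The value `∑ cₙ (h z)ⁿ`. -/
def hser (c : ℕ → Ch) (z : B) : B := evalPS B (serPS c z)

theorem map_hser (φ : A →ₐ[Ch] B) (c : ℕ → Ch) (z : A) : φ (hser c z) = hser c (φ z) :=
  map_evalPS_linear φ.toLinearMap _ _ fun n => by simp [coeff_serPS]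

theorem hser_mul (c : ℕ → Ch) {z w a : B} (hza : z * a = a * w) :
    hser c z * a = a * hser c w := by
  have := congrArg (evalPS B) (serPS_mul_C c hza)
  rwa [map_mul, map_mul, evalPS_C] at this

theorem commute_hser (c : ℕ → Ch) {z a : B} (hza : Commute z a) : Commute (hser c z) a :=
  hser_mul c hza

theorem hser_add {p : Ch} {c : ℕ → Ch} (hc : IsGauss p c) {a b : B} (hba : b * a = p • (a * b)) :
    hser c (a + b) = hser c a * hser c b := by
  rw [hser, serPS_add hc hba, map_mul]
  rfl

theorem isUnit_hser {c : ℕ → Ch} (hc : c 0 = 1) (z : B) : IsUnit (hser c z) := by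
  refine IsUnit.map (evalPS B) (PowerSeries.isUnit_iff_constantCoeff.2 ?_)
  rw [← coeff_zero_eq_constantCoeff_apply, coeff_serPS, hc]
  simp

theorem op_evalPS (f : PowerSeries B) (g : PowerSeries Bᵐᵒᵖ)
    (hg : ∀ n, coeff n g = MulOpposite.op (coeff n f)) :
    MulOpposite.op (evalPS B f) = evalPS Bᵐᵒᵖ g := by
  let φ : B →ₗ[Ch] Bᵐᵒᵖ :=
    { toFun := MulOpposite.op, map_add' := fun _ _ => rfl, map_smul' := fun _ _ => rfl }
  exact map_evalPS_linear φ f g hg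

theorem hser_op (c : ℕ → Ch) (z : B) : hser c (MulOpposite.op z) = MulOpposite.op (hser c z) :=
  (op_evalPS _ _ fun n => by
    rw [coeff_serPS, coeff_serPS, MulOpposite.op_smul, MulOpposite.op_pow]).symm

/-- This step produces the opposite coproduct. Writing `E` for the series, `h [P, wⁿ⁺¹] = [n+1]_p
(wⁿS - Twⁿ)`, and the Gauss number is absorbed by `c (n + 1)`; summation gives `PE - EP = ES - TE`.
-/
theorem hser_intertwine {p : Ch} {c : ℕ → Ch} (hc : IsGauss p c) {w P S T : B}
    (hP : h • (P * w - w * P) = S - T) (hS : S * w = p • (w * S)) (hT : w * T = p • (T * w)) :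
    hser c w * (P + S) = (P + T) * hser c w := by
  set G : ℕ → Ch := fun n => ∑ i ∈ range n, p ^ i with hG
  have hG1 : ∀ n, G (n + 1) = G n + p ^ n := fun n => sum_range_succ _ _
  have hG2 : ∀ n, G (n + 1) = p * G n + 1 := fun n => by
    simp only [hG, sum_range_succ', mul_sum, pow_succ', pow_zero]
  have hwT : ∀ n, w ^ n * T = p ^ n • (T * w ^ n) := fun n => by
    induction n with
    | zero => simp
    | succ n ih =>
      rw [pow_succ', mul_assoc, ih, mul_smul_comm, ← mul_assoc, hT, smul_mul_assoc, smul_smul,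
        pow_succ, mul_assoc]
  have key : ∀ n, h • (P * w ^ (n + 1) - w ^ (n + 1) * P) =
      G (n + 1) • (w ^ n * S - T * w ^ n) := fun n => by
    induction n with
    | zero => simpa [hG] using hP
    | succ n ih =>
      -- Leibniz rule for the commutator with `P`.
      have e : P * w ^ (n + 2) - w ^ (n + 2) * P =
          (P * w ^ (n + 1) - w ^ (n + 1) * P) * w + w ^ (n + 1) * (P * w - w * P) := by
        rw [pow_succ w (n + 1)]
        noncomm_ring
      rw [e, smul_add, ← smul_mul_assoc, ih, ← mul_smul_comm, hP, mul_sub, hwT, smul_mul_assoc,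
        sub_mul, mul_assoc, hS, mul_smul_comm, ← mul_assoc, mul_assoc T, ← pow_succ]
      simp only [smul_sub, smul_smul]
      -- The terms with `S` and with `T` add up by different recursions: `[n+2] = p[n+1] + 1` for
      -- `S`, and `[n+2] = [n+1] + pⁿ⁺¹` for `T`.
      conv_rhs => rw [hG2 (n + 1), add_smul, one_smul, ← hG2 (n + 1), hG1 (n + 1), add_smul,
        mul_comm p]
      abel
  -- The constant term of the series is a scalar and commutes with `P`, so the commutator is
  -- divisible by `X`. Evaluation turns this `X` into the factor `h` required by `key`.
  have e1 : C P * serPS c w - serPS c w * C P =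
      X * PowerSeries.mk fun n => c (n + 1) • (P * w ^ (n + 1) - w ^ (n + 1) * P) := by
    ext n
    rw [map_sub, coeff_C_mul, coeff_mul_C, coeff_serPS]
    cases n with
    | zero => simp
    | succ n => rw [coeff_succ_X_mul, coeff_mk, mul_smul_comm, smul_mul_assoc, smul_sub]
  have e2 : (PowerSeries.mk fun n => h • c (n + 1) • (P * w ^ (n + 1) - w ^ (n + 1) * P)) =
      serPS c w * C S - C T * serPS c w := by
    ext n
    rw [map_sub, coeff_C_mul, coeff_mul_C, coeff_serPS, coeff_mk, smul_comm, key, smul_smul,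
      hc.succ, mul_smul_comm, smul_mul_assoc, smul_sub]
  have e3 := congrArg (evalPS B) e1
  rw [evalPS_X_mul, ← evalPS_mk_h_smul, e2] at e3
  simp only [map_sub, map_mul, evalPS_C] at e3
  rw [hser, mul_add, add_mul, ← sub_eq_zero]
  rw [← sub_eq_zero] at e3
  rw [← neg_eq_zero, ← e3]
  abel

end HSer

/-! ### The exponential `e^{hz}` and the bracket `[z]` -/

/-- The coefficients of the exponential series. -/
def expCoef (n : ℕ) : Ch := C ((n.factorial : ℂ)⁻¹)

/-- At `p = 1` the Gauss number is an ordinary integer, so the ordinary exponential is covered by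
the results proved for the quantum one. -/
theorem isGauss_expCoef : IsGauss 1 expCoef where
  zero := by simp [expCoef]
  succ n := by
    have : (∑ i ∈ range (n + 1), (1 : Ch) ^ i) = C ((n : ℂ) + 1) := by simp
    rw [this, expCoef, expCoef, ← map_mul, Nat.factorial_succ]
    congr 1
    have := Nat.factorial_ne_zero n
    have := Nat.cast_add_one_ne_zero (R := ℂ) n
    push_cast
    field_simp

section Exp

variable {A B : Type} [Ring A] [Algebra Ch A] [HComplete A] [Ring B] [Algebra Ch B] [HComplete B]

/-- The exponential `e^{hz}`. -/
abbrev hexp (z : B) : B := hser expCoef z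

theorem hexp_add {z w : B} (hzw : Commute z w) : hexp (z + w) = hexp z * hexp w :=
  hser_add isGauss_expCoef (by rw [one_smul, hzw.eq])

theorem hexp_zero : hexp (0 : B) = 1 := by
  rw [hexp, hser, ← map_one (evalPS B)]
  congr 1
  ext n
  cases n <;> simp [coeff_serPS, coeff_one, isGauss_expCoef.zero]

theorem hexp_mul_hexp_neg (z : B) : hexp z * hexp (-z) = 1 := by
  rw [← hexp_add (Commute.neg_right (Commute.refl z)), add_neg_cancel, hexp_zero]

theorem hexp_C (r : ℂ) : hexp (C r : Ch) = rescale r (PowerSeries.exp ℂ) := by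
  refine (eq_evalPS fun n => ?_).symm
  obtain ⟨c, hc⟩ : X ^ n ∣ (rescale r (PowerSeries.exp ℂ) -
      ∑ i ∈ range n, h ^ i • coeff i (serPS expCoef (C r : Ch)) : Ch) := by
    refine X_pow_dvd_iff.2 fun m hm => ?_
    rw [map_sub, map_sum, sub_eq_zero, sum_eq_single_of_mem m (mem_range.2 hm)]
    · rw [coeff_serPS, smul_eq_mul, h, smul_eq_mul, coeff_X_pow_mul', if_pos le_rfl, Nat.sub_self,
        expCoef, ← map_pow, ← map_mul, coeff_rescale, coeff_exp]
      simp [mul_comm]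
    · intro i _ him
      rw [coeff_serPS, smul_eq_mul, h, smul_eq_mul, coeff_X_pow_mul', expCoef, ← map_pow, ← map_mul]
      split_ifs with hi
      · rw [coeff_C, if_neg (by omega)]
      · rfl
  exact ⟨c, hc⟩

/-- The factor `2` comes from `q = e^{h/2}`. -/
theorem hexp_smul_one (r : ℂ) : hexp ((C r : Ch) • (1 : B)) = qPow (2 * r) • (1 : B) := by
  have := map_hser (Algebra.ofId Ch B) expCoef (C r)
  rw [show hser expCoef (C r : Ch) = _ from hexp_C r, Algebra.ofId_apply, Algebra.ofId_apply,
    Algebra.algebraMap_eq_smul_one,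
    Algebra.algebraMap_eq_smul_one] at this
  rw [show hexp ((C r : Ch) • (1 : B)) = _ from this.symm, qPow, mul_div_cancel_left₀ r two_ne_zero]

/-- `e^{hz} a = q^s a e^{hz}` if `[z, a] = (s / 2) a`. -/
theorem hexp_mul_of_eigen {z a : B} (s : ℂ) (hza : z * a = a * (z + (C (s / 2) : Ch) • 1)) :
    hexp z * a = qPow s • (a * hexp z) := by
  have hcomm : Commute z ((C (s / 2) : Ch) • (1 : B)) := (Commute.one_right z).smul_right _
  rw [hexp, hser_mul _ hza, ← hexp, hexp_add hcomm, hexp_smul_one, mul_div_cancel₀ s two_ne_zero,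
    mul_smul_comm, mul_smul_comm, mul_one]

/-- The power series `(e^{Xz/2} - e^{-Xz/2}) / X`. -/
def sinhPS (z : B) : PowerSeries B :=
  divh (serPS expCoef ((C (1 / 2) : Ch) • z) - serPS expCoef ((C (-1 / 2) : Ch) • z))

omit [HComplete B] in
theorem sinhPS_mul_X (z : B) : sinhPS z * X =
    serPS expCoef ((C (1 / 2) : Ch) • z) - serPS expCoef ((C (-1 / 2) : Ch) • z) := by
  refine divh_mul_X _ ?_
  rw [← coeff_zero_eq_constantCoeff_apply, map_sub, coeff_serPS, coeff_serPS, pow_zero, pow_zero,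
    sub_self]

/-- The bracket `[z] = (e^{hz/2} - e^{-hz/2}) / (q - q⁻¹)`. -/
def bracket (z : B) : B := (divh qDiff)⁻¹ • evalPS B (sinhPS z)

theorem qDiff_smul_bracket (z : B) : qDiff • bracket z =
    hexp ((C (1 / 2) : Ch) • z) - hexp ((C (-1 / 2) : Ch) • z) := by
  rw [bracket, smul_smul, show qDiff * (divh qDiff)⁻¹ = h * divh qDiff * (divh qDiff)⁻¹ by
    rw [← qDiff_eq], mul_assoc, PowerSeries.mul_inv_cancel _ (by rw [divqDiff_const]; simp),
      mul_one, ← evalPS_X_mul,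
    ← (commute_X _).eq, sinhPS_mul_X, map_sub]
  rfl

/-- With `z = H ⊗ 1` and `w = 1 ⊗ H` this is the relation for `[x, y]` under the coproduct. -/
theorem bracket_add {z w : B} (hzw : Commute z w) : bracket (z + w) =
    bracket z * hexp ((C (1 / 2) : Ch) • w) + hexp ((C (-1 / 2) : Ch) • z) * bracket w := by
  have hs : ∀ r : ℂ, serPS expCoef ((C r : Ch) • (z + w)) =
      serPS expCoef ((C r : Ch) • z) * serPS expCoef ((C r : Ch) • w) := fun r => by
    rw [smul_add]
    refine serPS_add isGauss_expCoef ?_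
    rw [one_smul]
    exact ((hzw.smul_left _).smul_right _).eq.symm
  have key : sinhPS (z + w) = sinhPS z * serPS expCoef ((C (1 / 2) : Ch) • w) +
      serPS expCoef ((C (-1 / 2) : Ch) • z) * sinhPS w := by
    -- The identity is proved before evaluation: `X` can be cancelled from power series, whereas `h`
    -- is not assumed to be cancellable in `B`.
    have : sinhPS (z + w) * X = (sinhPS z * serPS expCoef ((C (1 / 2) : Ch) • w) +
      serPS expCoef ((C (-1 / 2) : Ch) • z) * sinhPS w) * X := by
      rw [add_mul, mul_assoc (sinhPS z), (commute_X (serPS _ _)).eq, ← mul_assoc,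
        mul_assoc _ (sinhPS w),
        sinhPS_mul_X, sinhPS_mul_X, sinhPS_mul_X, hs, hs]
      noncomm_ring
    ext n
    simpa only [coeff_succ_mul_X] using congrArg (coeff (n + 1)) this
  rw [bracket, key, map_add, map_mul, map_mul, smul_add, bracket, bracket, smul_mul_assoc,
    mul_smul_comm]
  rfl

theorem bracket_neg (z : B) : bracket (-z) = -bracket z := by
  have : sinhPS (-z) = -sinhPS z := by
    have h1 : ∀ r : ℂ, (C r : Ch) • -z = (C (-r) : Ch) • z := fun r => by
      rw [map_neg, smul_neg, neg_smul]
    ext n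
    rw [map_neg, sinhPS, sinhPS, h1, h1, neg_div, neg_neg]
    simp only [divh, coeff_mk, map_sub, neg_sub]
  rw [bracket, this, map_neg, smul_neg, bracket]

theorem bracket_zero : bracket (0 : B) = 0 := by
  have : sinhPS (0 : B) = 0 := by
    ext n
    rw [sinhPS, smul_zero, smul_zero, sub_self, divh, coeff_mk, map_zero, map_zero]
  rw [bracket, this, map_zero, smul_zero]

omit [HComplete B] in
theorem coeff_sinhPS (z : B) (n : ℕ) : coeff n (sinhPS z) =
    expCoef (n + 1) • ((C (1 / 2) : Ch) • z) ^ (n + 1) -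
      expCoef (n + 1) • ((C (-1 / 2) : Ch) • z) ^ (n + 1) := by
  rw [sinhPS, divh, coeff_mk, map_sub, coeff_serPS, coeff_serPS]

theorem map_bracket (φ : A →ₐ[Ch] B) (z : A) : φ (bracket z) = bracket (φ z) := by
  rw [bracket, map_smul, bracket]
  congr 1
  exact map_evalPS_linear φ.toLinearMap _ _ fun n => by simp [coeff_sinhPS]

theorem bracket_op (z : B) : bracket (MulOpposite.op z) = MulOpposite.op (bracket z) := by
  rw [bracket, bracket, MulOpposite.op_smul]
  congr 1
  exact (op_evalPS _ _ fun n => by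
    simp only [coeff_sinhPS, MulOpposite.op_smul, MulOpposite.op_pow, MulOpposite.op_sub]).symm

end Exp

/-! ### Quantum numbers -/

theorem qPow_mul (r s : ℂ) : qPow r * qPow s = qPow (r + s) := by
  rw [qPow, qPow, exp_mul_exp_eq_exp_add, qPow, add_div]

theorem qPow_zero : qPow 0 = 1 := by
  rw [qPow, zero_div, rescale_zero_apply]
  simp

theorem qPow_pow (r : ℂ) (n : ℕ) : qPow r ^ n = qPow (n * r) := by
  induction n with
  | zero => simp [qPow_zero]
  | succ n ih => rw [pow_succ, ih, qPow_mul]; push_cast; ring_nf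

theorem qDiff_ne_zero : qDiff ≠ 0 := by
  intro h0
  have := divqDiff_const
  rw [h0] at this
  simp [divh, ← coeff_zero_eq_constantCoeff_apply] at this

/-- The symmetric quantum integer `[n]` is `qⁿ⁻¹` times the Gauss number for `p = q⁻²`. After
multiplication by `q - q⁻¹`, which can be cancelled in the domain `ℂ⟦h⟧`, the sum telescopes. -/
theorem qPow_mul_gauss (n : ℕ) :
    qPow (n - 1) * ∑ i ∈ range n, qPow (-2) ^ i = qInt n := by
  refine mul_right_cancel₀ qDiff_ne_zero ?_
  rw [qInt_mul]
  induction n with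
  | zero => simp
  | succ n ih =>
    have e : qPow (n - 1) * qPow 1 = qPow n := by rw [qPow_mul]; ring_nf
    have e2 : qPow (n - 1) = qPow n * qPow (-1) := by rw [qPow_mul]; ring_nf
    rw [sum_range_succ, qPow_pow, Nat.cast_succ, add_sub_cancel_right, mul_add, add_mul]
    have h1 : qPow n * (∑ i ∈ range n, qPow (-2) ^ i) * qDiff =
        qPow 1 * (qPow n - qPow (-n)) := by rw [← ih, ← e]; ring
    rw [h1, mul_sub, qDiff, qPow_mul, qPow_mul, qPow_mul, mul_sub, qPow_mul, qPow_mul]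
    ring_nf

/-- The coefficients `q^{n(n-1)/2} / [n]!` of the quantum exponential function. -/
def qCoef (n : ℕ) : Ch := qPow (n * (n - 1) / 2) * (qFact n)⁻¹

/-- The prefactor `q^{n(n-1)/2}` collects the powers `qⁿ⁻¹` separating the quantum integers from the
Gauss numbers. -/
theorem isGauss_qCoef : IsGauss (qPow (-2)) qCoef where
  zero := by simp [qCoef, qFact, qPow_zero]
  succ n := by
    have h0 : constantCoeff (qInt (n + 1)) ≠ 0 := by
      rw [qInt_const]
      exact_mod_cast Nat.succ_ne_zero n
    have e1 : qPow (↑(n + 1) * (↑(n + 1) - 1) / 2) =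
        qPow (n * (n - 1) / 2) * qPow (↑(n + 1) - 1) := by
      rw [qPow_mul]; congr 1; push_cast; ring
    rw [qCoef, e1, mul_right_comm, mul_assoc (qPow (n * (n - 1) / 2)), qPow_mul_gauss,
      qFact, prod_range_succ, PowerSeries.mul_inv_rev, mul_assoc, ← mul_assoc (qInt (n + 1)),
      PowerSeries.mul_inv_cancel _ h0, one_mul, qCoef, qFact]

namespace Uh

/-! ### The universal property of `U_h(sl₂)` -/

theorem algebraMap_eq (r : Ch) : algebraMap Ch Uh r = mk (scalar r) := rfl

theorem smul_mk (r : Ch) (f : PowerSeries FreeAlg) : r • mk f = mk (scalar r * f) := by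
  rw [Algebra.smul_def, algebraMap_eq, ← map_mul]

theorem scalar_X : scalar X = X := by simp [scalar]

theorem mk_X_mul (f : PowerSeries FreeAlg) : mk (X * f) = h • mk f := by
  rw [smul_mk, h, scalar_X]

theorem mk_X_pow_mul (n : ℕ) (f : PowerSeries FreeAlg) : mk (X ^ n * f) = h ^ n • mk f := by
  rw [smul_mk, map_pow, h, scalar_X]

theorem mk_C_smul (r : ℂ) (w : FreeAlg) : mk (C (r • w)) = (C r : Ch) • mk (C w) := by
  rw [smul_mk, scalar, map_C, ← map_mul, Algebra.smul_def]

theorem mk_C_algebraMap (r : ℂ) : mk (C (algebraMap ℂ FreeAlg r)) = (C r : Ch) • (1 : Uh) := by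
  rw [Algebra.algebraMap_eq_smul_one, mk_C_smul, map_one, map_one]

theorem mk_eq_zero_iff {f : PowerSeries FreeAlg} : mk f = 0 ↔ f ∈ relIdeal := by
  rw [TwoSidedIdeal.mem_iff]
  exact RingCon.eq relIdeal.ringCon

theorem mem_relIdeal {f : PowerSeries FreeAlg} : f ∈ relIdeal ↔
    ∀ n, f ∈ TwoSidedIdeal.span relators ⊔ TwoSidedIdeal.span {X ^ n} :=
  TwoSidedIdeal.mem_iInf _

theorem mk_relator {f : PowerSeries FreeAlg} (hf : f ∈ relators) : mk f = 0 :=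
  mk_eq_zero_iff.2 (mem_relIdeal.2 fun _ =>
    TwoSidedIdeal.mem_sup_left (TwoSidedIdeal.subset_span hf))

/-- Separatedness is what taking the closure of the ideal provides; the existence of sums is
inherited from power series over the free algebra. -/
instance : HComplete Uh where
  sep b hb := by
    obtain ⟨f, rfl⟩ := mk_surjective b
    refine mk_eq_zero_iff.2 (mem_relIdeal.2 fun n => ?_)
    obtain ⟨c, hc⟩ := hb n
    obtain ⟨g, rfl⟩ := mk_surjective c
    rw [← mk_X_pow_mul, ← sub_eq_zero, ← map_sub, mk_eq_zero_iff] at hc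
    have := add_mem (mem_relIdeal.1 hc n) (TwoSidedIdeal.mem_sup_right
      (TwoSidedIdeal.mul_mem_right _ _ g
        (TwoSidedIdeal.subset_span (Set.mem_singleton (X ^ n : PowerSeries FreeAlg)))))
    rwa [sub_add_cancel] at this
  prec a := by
    choose F hF using fun n => mk_surjective (a n)
    refine ⟨mk (PowerSeries.mk fun m => ∑ i ∈ range (m + 1), coeff (m - i) (F i)), fun n => ?_⟩
    obtain ⟨c, hc⟩ : X ^ n ∣
        (PowerSeries.mk (fun m => ∑ i ∈ range (m + 1), coeff (m - i) (F i)) -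
        ∑ i ∈ range n, X ^ i * F i) := by
      refine X_pow_dvd_iff.2 fun m hm => ?_
      rw [map_sub, coeff_mk, map_sum, sub_eq_zero]
      simp only [coeff_X_pow_mul']
      rw [← sum_subset (range_subset_range.2 hm)]
      · refine sum_congr rfl fun i hi => (if_pos ?_).symm
        simpa [Nat.lt_succ_iff] using hi
      · intro i _ hi
        exact if_neg (by simpa using hi)
    refine ⟨mk c, ?_⟩
    rw [← mk_X_pow_mul, ← hc, map_sub, map_sum]
    simp only [mk_X_pow_mul, hF]

/-- Formal series such as `freeExpH` and `freeBracketH` thereby become convergent sums in `U`, to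
which the calculus of `hexp` and `bracket` applies. -/
theorem mk_eq_evalPS (f : PowerSeries FreeAlg) :
    mk f = evalPS Uh (PowerSeries.map (mk.comp C) f) := by
  rw [← sub_eq_zero]
  refine eq_zero_of_forall_eq_h_smul
    (fun f => mk f - evalPS Uh (PowerSeries.map (mk.comp C) f))
    (fun f => ⟨PowerSeries.mk fun p => coeff (p + 1) f, ?_⟩) f
  conv_lhs => rw [eq_X_mul_shift_add_const f]
  have hX : mk X = h • 1 := by rw [← mul_one X, mk_X_mul, map_one]
  simp only [map_add, map_mul, map_X, hX, evalPS_X, map_C, evalPS_C, smul_sub]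
  simp

/-! ### Density of the subalgebra generated by `x`, `y`, `H`. -/

section Density

variable {B : Type} [Ring B] [Algebra Ch B] [HComplete B]

/-- Closure under products is a hypothesis, so that the lemma also applies to the maps `m(S⊗id)Δ`
and `m(id⊗S)Δ`, which are not given as homomorphisms. -/
theorem linearMap_ext {f g : Uh →ₗ[Ch] B} (h1 : f 1 = g 1) (hx : f x = g x) (hy : f y = g y)
    (hH : f H = g H) (hmul : ∀ a b, f a = g a → f b = g b → f (a * b) = g (a * b)) : f = g := by
  have hC : ∀ w : FreeAlg, f (mk (C w)) = g (mk (C w)) := by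
    intro w
    induction w using FreeAlgebra.induction with
    | grade0 r => rw [mk_C_algebraMap, map_smul, map_smul, h1]
    | grade1 i => cases i <;> assumption
    | mul a b ha hb => rw [map_mul, map_mul]; exact hmul _ _ ha hb
    | add a b ha hb => simp only [map_add, ha, hb]
  ext u
  obtain ⟨F, rfl⟩ := mk_surjective u
  rw [← sub_eq_zero]
  refine eq_zero_of_forall_eq_h_smul (fun F => f (mk F) - g (mk F))
    (fun F => ⟨PowerSeries.mk fun p => coeff (p + 1) F, ?_⟩) F
  conv_lhs => rw [eq_X_mul_shift_add_const F]
  simp only [map_add, mk_X_mul, map_smul, hC, smul_sub]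
  abel

theorem algHom_ext {f g : Uh →ₐ[Ch] B} (hx : f x = g x) (hy : f y = g y) (hH : f H = g H) :
    f = g := by
  have : f.toLinearMap = g.toLinearMap := linearMap_ext (by simp) hx hy hH
    (fun a b ha hb => by
      simp only [AlgHom.toLinearMap_apply] at ha hb ⊢
      rw [map_mul, map_mul, ha, hb])
  exact AlgHom.ext fun a => LinearMap.congr_fun this a

end Density

/-! ### Homomorphisms from `U` to complete algebras. -/

section Lift

variable {B : Type} [Ring B] [Algebra Ch B]

/-- The values of the generators given by a triple. -/
def genVal (X Y K : B) : Gen → B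
  | .x => X
  | .y => Y
  | .H => K

/-- The homomorphism from the free algebra with prescribed values on the generators. -/
def freeLift (v : Gen → B) : FreeAlg →+* B :=
  letI : Algebra ℂ B := Algebra.compHom B (C : ℂ →+* Ch)
  (FreeAlgebra.lift ℂ v).toRingHom

theorem freeLift_ι (v : Gen → B) (g : Gen) : freeLift v (FreeAlgebra.ι ℂ g) = v g := by
  let _ : Algebra ℂ B := Algebra.compHom B (C : ℂ →+* Ch)
  exact FreeAlgebra.lift_ι_apply v g

theorem freeLift_algebraMap (v : Gen → B) (r : ℂ) :
    freeLift v (algebraMap ℂ FreeAlg r) = algebraMap Ch B (C r) := by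
  let _ : Algebra ℂ B := Algebra.compHom B (C : ℂ →+* Ch)
  exact (FreeAlgebra.lift ℂ v).commutes r

theorem map_freeExpH (φ : FreeAlg →+* B)
    (hφ : ∀ (r : ℂ) (w : FreeAlg), φ (r • w) = (C r : Ch) • φ w) (c : ℂ) :
    PowerSeries.map φ (freeExpH c) =
      serPS expCoef ((C c : Ch) • φ (FreeAlgebra.ι ℂ Gen.H)) := by
  ext n
  rw [coeff_map, freeExpH, coeff_mk, hφ, map_pow φ, coeff_serPS, smul_pow, smul_smul, expCoef,
    ← map_pow C, ← map_mul C, div_eq_inv_mul]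

theorem map_divh {R S : Type} [Ring R] [Ring S] (φ : R →+* S) (f : PowerSeries R) :
    PowerSeries.map φ (divh f) = divh (PowerSeries.map φ f) := by
  ext n
  simp [divh]

variable [HComplete B]

theorem evalPS_map_scalar (φ : FreeAlg →+* B)
    (hφ : ∀ r : ℂ, φ (algebraMap ℂ FreeAlg r) = algebraMap Ch B (C r)) (r : Ch) :
    evalPS B (PowerSeries.map φ (scalar r)) = algebraMap Ch B r := by
  rw [← sub_eq_zero]
  refine eq_zero_of_forall_eq_h_smul
    (fun r => evalPS B (PowerSeries.map φ (scalar r)) - algebraMap Ch B r)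
    (fun r => ⟨PowerSeries.mk fun p => coeff (p + 1) r, ?_⟩) r
  conv_lhs => rw [eq_X_mul_shift_add_const r]
  simp only [map_add, map_mul, scalar_X, map_X, evalPS_X, smul_sub, ← Algebra.smul_def]
  simp [scalar, hφ]

theorem evalPS_map_freeBracketH (φ : FreeAlg →+* B)
    (hφ : ∀ r : ℂ, φ (algebraMap ℂ FreeAlg r) = algebraMap Ch B (C r)) :
    evalPS B (PowerSeries.map φ freeBracketH) = bracket (φ (FreeAlgebra.ι ℂ Gen.H)) := by
  have hs : ∀ (r : ℂ) (w : FreeAlg), φ (r • w) = (C r : Ch) • φ w := fun r w => by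
    rw [Algebra.smul_def, map_mul, hφ, Algebra.smul_def]
  rw [freeBracketH, map_mul, map_mul, evalPS_map_scalar φ hφ, ← Algebra.smul_def, map_divh,
    map_sub, map_freeExpH φ hs, map_freeExpH φ hs, bracket, sinhPS]

/-- The evaluation of power series over the free algebra at a triple of elements. -/
def preLift (X Y K : B) : PowerSeries FreeAlg →+* B :=
  (evalPS B).comp (PowerSeries.map (freeLift (genVal X Y K)))

theorem preLift_gen (X Y K : B) (g : Gen) : preLift X Y K (gen g) = genVal X Y K g := by
  rw [preLift, RingHom.comp_apply, gen, map_C, evalPS_C, freeLift_ι]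

/-- Modulo `hⁿ` both the relators and `Xⁿ` are killed, hence so is the closed ideal; since this
holds for all `n`, separatedness of `B` concludes. -/
theorem preLift_eq_zero {X Y K : B} (hX : K * X - X * K = 2 * X) (hY : K * Y - Y * K = -(2 * Y))
    (hXY : X * Y - Y * X = bracket K) {f : PowerSeries FreeAlg} (hf : f ∈ relIdeal) :
    preLift X Y K f = 0 := by
  refine HComplete.sep _ fun n => ?_
  let π := (Ideal.Quotient.mk (hIdeal B n)).comp (preLift X Y K)
  have hle : TwoSidedIdeal.span relators ⊔ TwoSidedIdeal.span {PowerSeries.X ^ n} ≤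
      TwoSidedIdeal.ker π := by
    refine sup_le (TwoSidedIdeal.span_le.2 ?_) (TwoSidedIdeal.span_le.2 ?_)
    · intro g hg
      have h0 : preLift X Y K g = 0 := by
        rcases hg with rfl | rfl | rfl
        · simp only [map_sub, map_mul, preLift_gen, genVal, map_ofNat, hX, sub_self]
        · simp only [map_sub, map_add, map_mul, preLift_gen, genVal, map_ofNat, hY]
          exact neg_add_cancel _
        · simp only [map_sub, map_mul, preLift_gen, genVal, hXY]
          rw [preLift, RingHom.comp_apply, evalPS_map_freeBracketH _ (freeLift_algebraMap _),
            freeLift_ι]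
          exact sub_self _
      rw [SetLike.mem_coe, TwoSidedIdeal.mem_ker, RingHom.comp_apply, h0, map_zero]
    · rintro _ rfl
      rw [SetLike.mem_coe, TwoSidedIdeal.mem_ker, RingHom.comp_apply,
        Ideal.Quotient.eq_zero_iff_mem]
      refine ⟨1, ?_⟩
      rw [preLift, RingHom.comp_apply, map_pow, map_X, map_pow, evalPS_X, smul_pow, one_pow]
  have := hle (mem_relIdeal.1 hf n)
  rwa [TwoSidedIdeal.mem_ker, RingHom.comp_apply, Ideal.Quotient.eq_zero_iff_mem] at this

/-- The homomorphism from `U_h(sl₂)` to a complete algebra with prescribed values on the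
generators. -/
def lift (X Y K : B) (hX : K * X - X * K = 2 * X) (hY : K * Y - Y * K = -(2 * Y))
    (hXY : X * Y - Y * X = bracket K) : Uh →ₐ[Ch] B where
  __ := relIdeal.ringCon.lift (preLift X Y K) (fun f g hfg => by
    have := preLift_eq_zero hX hY hXY ((TwoSidedIdeal.rel_iff _ _ _).1 hfg)
    rw [map_sub, sub_eq_zero] at this
    exact this)
  commutes' r := evalPS_map_scalar _ (freeLift_algebraMap _) r

variable {X Y K : B} (hX : K * X - X * K = 2 * X) (hY : K * Y - Y * K = -(2 * Y))
    (hXY : X * Y - Y * X = bracket K)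

theorem lift_x : lift X Y K hX hY hXY x = X := preLift_gen X Y K .x

theorem lift_y : lift X Y K hX hY hXY y = Y := preLift_gen X Y K .y

theorem lift_H : lift X Y K hX hY hXY H = K := preLift_gen X Y K .H

end Lift

/-! ### Relations in `U_h(sl₂)` -/

theorem mk_freeExpH (c : ℂ) : mk (freeExpH c) = hexp ((C c : Ch) • H) := by
  rw [mk_eq_evalPS, map_freeExpH (mk.comp C) mk_C_smul]
  rfl

theorem k_eq : k = hexp ((C (1 / 4) : Ch) • H) := mk_freeExpH _

theorem kInv_eq : kInv = hexp ((C (-1 / 4) : Ch) • H) := mk_freeExpH _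

theorem kInv_mul_k : kInv * k = 1 := by
  rw [kInv_eq, k_eq, neg_div, map_neg, neg_smul]
  simpa using hexp_mul_hexp_neg (-((C (1 / 4) : Ch) • H))

theorem H_mul_x : H * x - x * H = 2 * x := by
  have := mk_relator (f := gen .H * gen .x - gen .x * gen .H - 2 * gen .x) (Or.inl rfl)
  rw [map_sub, sub_eq_zero, map_mul mk 2, map_ofNat, map_sub, map_mul, map_mul] at this
  exact this

theorem H_mul_y : H * y - y * H = -(2 * y) := by
  have := mk_relator (f := gen .H * gen .y - gen .y * gen .H + 2 * gen .y) (Or.inr (Or.inl rfl))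
  rw [map_add, ← eq_neg_iff_add_eq_zero, map_mul mk 2, map_ofNat, map_sub, map_mul,
    map_mul] at this
  exact this

theorem x_mul_y : x * y - y * x = bracket H := by
  have := mk_relator (f := gen .x * gen .y - gen .y * gen .x - freeBracketH) (Or.inr (Or.inr rfl))
  rw [map_sub, sub_eq_zero, map_sub, map_mul, map_mul, mk_eq_evalPS freeBracketH,
    evalPS_map_freeBracketH] at this
  · exact this
  · intro r
    rw [RingHom.comp_apply, mk_C_algebraMap, Algebra.algebraMap_eq_smul_one]

end Uh

open Completion

/-! ### Completed tensor products -/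

section Tensor

variable {A : Type} [Ring A] [Algebra Ch A]

theorem T2.linearMap_ext {B : Type} [Ring B] [Algebra Ch B] [HComplete B] {f g : T2 A →ₗ[Ch] B}
    (hfg : ∀ a b : A, f (of _ (a ⊗ₜ[Ch] b)) = g (of _ (a ⊗ₜ[Ch] b))) : f = g := by
  refine Completion.linearMap_ext fun t => ?_
  have : f ∘ₗ (of (A ⊗[Ch] A)).toLinearMap = g ∘ₗ (of (A ⊗[Ch] A)).toLinearMap :=
    TensorProduct.ext' hfg
  exact LinearMap.congr_fun this t

/-- The homomorphism `a ⊗ b ↦ f(a) g(b)` for homomorphisms with commuting images. -/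
def mulHom {B : Type} [Ring B] [Algebra Ch B] (f g : A →ₐ[Ch] Completion B)
    (hfg : ∀ a b, Commute (f a) (g b)) : T2 A →ₐ[Ch] Completion B :=
  extendHom (Algebra.TensorProduct.lift f g hfg)

theorem mulHom_of_tmul {B : Type} [Ring B] [Algebra Ch B] (f g : A →ₐ[Ch] Completion B)
    (hfg : ∀ a b, Commute (f a) (g b)) (a b : A) :
    mulHom f g hfg (of _ (a ⊗ₜ[Ch] b)) = f a * g b := by
  rw [mulHom, extendHom_of, Algebra.TensorProduct.lift_tmul]

theorem mulHom_apply {B : Type} [Ring B] [Algebra Ch B] (f g : A →ₐ[Ch] Completion B)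
    (hfg : ∀ a b, Commute (f a) (g b)) (t : T2 A) :
    mulHom f g hfg t = mulMap f.toLinearMap g.toLinearMap t := by
  have : (mulHom f g hfg).toLinearMap = mulMap f.toLinearMap g.toLinearMap :=
    T2.linearMap_ext fun a b => by
      rw [AlgHom.toLinearMap_apply, mulHom_of_tmul, mulMap_of_tmul]; rfl
  exact LinearMap.congr_fun this t

theorem twist_of_tmul (a b : A) : twist A (of _ (a ⊗ₜ[Ch] b)) = of _ (b ⊗ₜ[Ch] a) := rfl

theorem leg12_of_tmul (a b : A) :
    leg12 A (of _ (a ⊗ₜ[Ch] b)) = of _ (a ⊗ₜ[Ch] (b ⊗ₜ[Ch] (1 : A))) := rfl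

theorem leg23_of (t : A ⊗[Ch] A) : leg23 A (of _ t) = of _ (1 ⊗ₜ[Ch] t) := rfl

theorem leg1_apply (a : A) : leg1 A a = of _ (a ⊗ₜ[Ch] 1) := rfl

theorem leg3_apply (a : A) : leg3 A a = of _ (1 ⊗ₜ[Ch] (1 ⊗ₜ[Ch] a)) := rfl

theorem commute_leg12_leg3 (t : T2 A) (b : A) : Commute (leg12 A t) (leg3 A b) := by
  have : LinearMap.mulRight Ch (leg3 A b) ∘ₗ (leg12 A).toLinearMap =
      LinearMap.mulLeft Ch (leg3 A b) ∘ₗ (leg12 A).toLinearMap :=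
    T2.linearMap_ext fun a a' => by
      simp only [LinearMap.comp_apply, AlgHom.toLinearMap_apply, LinearMap.mulRight_apply,
        LinearMap.mulLeft_apply, leg12_of_tmul, leg3_apply, ← map_mul,
        Algebra.TensorProduct.tmul_mul_tmul, one_mul, mul_one]
  exact LinearMap.congr_fun this t

theorem commute_leg1_leg23 (a : A) (t : T2 A) : Commute (leg1 A a) (leg23 A t) := by
  have : LinearMap.mulLeft Ch (leg1 A a) ∘ₗ (leg23 A).toLinearMap =
      LinearMap.mulRight Ch (leg1 A a) ∘ₗ (leg23 A).toLinearMap :=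
    T2.linearMap_ext fun b b' => by
      simp only [LinearMap.comp_apply, AlgHom.toLinearMap_apply, LinearMap.mulRight_apply,
        LinearMap.mulLeft_apply, leg23_of, leg1_apply, ← map_mul,
        Algebra.TensorProduct.tmul_mul_tmul, one_mul, mul_one]
  exact LinearMap.congr_fun this t

/-- `D ⊗ id` as an algebra homomorphism. -/
def tensorIdHom (D : A →ₐ[Ch] T2 A) : T2 A →ₐ[Ch] T3 A :=
  mulHom ((leg12 A).comp D) (leg3 A) fun a b => commute_leg12_leg3 (D a) b

/-- `id ⊗ D` as an algebra homomorphism. -/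
def idTensorHom (D : A →ₐ[Ch] T2 A) : T2 A →ₐ[Ch] T3 A :=
  mulHom (leg1 A) ((leg23 A).comp D) fun a b => commute_leg1_leg23 a (D b)

theorem tensorIdHom_apply (D : A →ₐ[Ch] T2 A) (t : T2 A) : tensorIdHom D t = tensorId D t :=
  mulHom_apply _ _ _ t

theorem idTensorHom_apply (D : A →ₐ[Ch] T2 A) (t : T2 A) : idTensorHom D t = idTensor D t :=
  mulHom_apply _ _ _ t

theorem tensorIdHom_of_tmul (D : A →ₐ[Ch] T2 A) (a b : A) :
    tensorIdHom D (of _ (a ⊗ₜ[Ch] b)) = leg12 A (D a) * leg3 A b :=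
  mulHom_of_tmul _ _ _ _ _

theorem idTensorHom_of_tmul (D : A →ₐ[Ch] T2 A) (a b : A) :
    idTensorHom D (of _ (a ⊗ₜ[Ch] b)) = leg1 A a * leg23 A (D b) :=
  mulHom_of_tmul _ _ _ _ _

/-! ### Products under `m(S⊗id)` and `m(id⊗S)`. -/

section Antipode

variable (S : A →ₐ[Ch] Aᵐᵒᵖ)

theorem antiToCompletion_apply (a : A) : antiToCompletion S a = of A (S a).unop := rfl

theorem scalarToCompletion_apply (e : A →ₐ[Ch] Ch) (a : A) :
    scalarToCompletion e a = e a • (1 : Completion A) :=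
  Algebra.algebraMap_eq_smul_one (A := Completion A) (e a)

/-- Since `S` reverses products, `φ(t (a⊗b)) = S(a) φ(t) b`; if `φ(t)` is a scalar it can be pulled
out. With `t` and `u` coproducts, this shows that the antipode identity passes to products. -/
theorem mulMap_anti_left_mul {t : T2 A} {c : Ch}
    (ht : mulMap (antiToCompletion S) (of A).toLinearMap t = c • 1) (u : T2 A) :
    mulMap (antiToCompletion S) (of A).toLinearMap (t * u) =
      c • mulMap (antiToCompletion S) (of A).toLinearMap u := by
  set φ := mulMap (antiToCompletion S) (of A).toLinearMap with hφ
  have hof : ∀ a b, φ (of _ (a ⊗ₜ[Ch] b)) = of A (S a).unop * of A b := mulMap_of_tmul _ _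
  have h1 : ∀ a b, φ ∘ₗ LinearMap.mulRight Ch (of _ (a ⊗ₜ[Ch] b)) =
      LinearMap.mulLeft Ch (of A (S a).unop) ∘ₗ LinearMap.mulRight Ch (of A b) ∘ₗ φ :=
    fun a b => T2.linearMap_ext fun a' b' => by
      simp only [LinearMap.comp_apply, LinearMap.mulRight_apply, LinearMap.mulLeft_apply,
        ← map_mul, Algebra.TensorProduct.tmul_mul_tmul, hof]
      simp only [map_mul, MulOpposite.unop_mul, mul_assoc]
  have h2 : φ ∘ₗ LinearMap.mulLeft Ch t = c • φ := T2.linearMap_ext fun a b => by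
    have := LinearMap.congr_fun (h1 a b) t
    simp only [LinearMap.comp_apply, LinearMap.mulRight_apply, LinearMap.mulLeft_apply, ht,
      smul_mul_assoc, mul_smul_comm, one_mul] at this
    rw [LinearMap.smul_apply, hof, ← this]
    rfl
  exact LinearMap.congr_fun h2 u

theorem mulMap_anti_right_mul {t : T2 A} {c : Ch}
    (ht : mulMap (of A).toLinearMap (antiToCompletion S) t = c • 1) (u : T2 A) :
    mulMap (of A).toLinearMap (antiToCompletion S) (u * t) =
      c • mulMap (of A).toLinearMap (antiToCompletion S) u := by
  set φ := mulMap (of A).toLinearMap (antiToCompletion S) with hφ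
  have hof : ∀ a b, φ (of _ (a ⊗ₜ[Ch] b)) = of A a * of A (S b).unop := mulMap_of_tmul _ _
  have h1 : ∀ a b, φ ∘ₗ LinearMap.mulLeft Ch (of _ (a ⊗ₜ[Ch] b)) =
      LinearMap.mulLeft Ch (of A a) ∘ₗ LinearMap.mulRight Ch (of A (S b).unop) ∘ₗ φ :=
    fun a b => T2.linearMap_ext fun a' b' => by
      simp only [LinearMap.comp_apply, LinearMap.mulRight_apply, LinearMap.mulLeft_apply,
        ← map_mul, Algebra.TensorProduct.tmul_mul_tmul, hof]
      simp only [map_mul, MulOpposite.unop_mul, mul_assoc]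
  have h2 : φ ∘ₗ LinearMap.mulRight Ch t = c • φ := T2.linearMap_ext fun a b => by
    have := LinearMap.congr_fun (h1 a b) t
    simp only [LinearMap.comp_apply, LinearMap.mulRight_apply, LinearMap.mulLeft_apply, ht,
      smul_mul_assoc, mul_smul_comm, one_mul] at this
    rw [LinearMap.smul_apply, hof, ← this]
    rfl
  exact LinearMap.congr_fun h2 u

end Antipode

end Tensor

namespace Uh

/-! ### More relations -/

theorem H_mul_x' : H * x = x * H + 2 * x := by rw [← H_mul_x]; abel

theorem H_mul_y' : H * y = y * H - 2 * y := by rw [sub_eq_add_neg, ← H_mul_y]; abel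

theorem hexp_smul_H_mul_x (r : ℂ) :
    hexp ((C r : Ch) • H) * x = qPow (4 * r) • (x * hexp ((C r : Ch) • H)) := by
  refine hexp_mul_of_eigen _ ?_
  rw [smul_mul_assoc, H_mul_x', mul_add, mul_smul_comm, mul_smul_comm, mul_one, smul_add,
    two_mul, ← two_smul Ch x, smul_smul, ← map_ofNat C, ← map_mul]
  ring_nf

theorem hexp_smul_H_mul_y (r : ℂ) :
    hexp ((C r : Ch) • H) * y = qPow (-4 * r) • (y * hexp ((C r : Ch) • H)) := by
  refine hexp_mul_of_eigen _ ?_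
  rw [smul_mul_assoc, H_mul_y', mul_add, mul_smul_comm, mul_smul_comm, mul_one, smul_sub,
    two_mul, ← two_smul Ch y, smul_smul, ← map_ofNat C, ← map_mul, sub_eq_add_neg, ← neg_smul,
    ← map_neg]
  ring_nf

theorem k_mul_x : k * x = qPow 1 • (x * k) := by
  rw [k_eq, hexp_smul_H_mul_x]; norm_num

theorem k_mul_y : k * y = qPow (-1) • (y * k) := by
  rw [k_eq, hexp_smul_H_mul_y]; norm_num

theorem kInv_mul_x : kInv * x = qPow (-1) • (x * kInv) := by
  rw [kInv_eq, hexp_smul_H_mul_x]; norm_num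

theorem kInv_mul_y : kInv * y = qPow 1 • (y * kInv) := by
  rw [kInv_eq, hexp_smul_H_mul_y]; norm_num

theorem H_mul_k : H * k = k * H := by
  rw [k_eq]
  exact (commute_hser _ ((Commute.refl H).smul_left _)).symm.eq

theorem H_mul_kInv : H * kInv = kInv * H := by
  rw [kInv_eq]
  exact (commute_hser _ ((Commute.refl H).smul_left _)).symm.eq

theorem hexp_half : hexp ((C (1 / 2) : Ch) • H) = k * k := by
  rw [k_eq, ← hexp_add (Commute.refl _), ← add_smul, ← map_add]
  norm_num

theorem hexp_neg_half : hexp ((C (-1 / 2) : Ch) • H) = kInv * kInv := by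
  rw [kInv_eq, ← hexp_add (Commute.refl _), ← add_smul, ← map_add]
  norm_num

theorem qDiff_smul_bracket_H : qDiff • bracket H = k * k - kInv * kInv := by
  rw [qDiff_smul_bracket, hexp_half, hexp_neg_half]

/-! ### The Hopf algebra structure -/

/-- `a ↦ a ⊗ 1`. -/
def inl : Uh →ₐ[Ch] T2 Uh := (of (Uh ⊗[Ch] Uh)).comp Algebra.TensorProduct.includeLeft

/-- `a ↦ 1 ⊗ a`. -/
def inr : Uh →ₐ[Ch] T2 Uh := (of (Uh ⊗[Ch] Uh)).comp Algebra.TensorProduct.includeRight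

theorem inl_apply (a : Uh) : inl a = of _ (a ⊗ₜ[Ch] 1) := rfl

theorem inr_apply (a : Uh) : inr a = of _ (1 ⊗ₜ[Ch] a) := rfl

theorem inl_mul_inr (a b : Uh) : inl a * inr b = of _ (a ⊗ₜ[Ch] b) := by
  rw [inl_apply, inr_apply, ← map_mul, Algebra.TensorProduct.tmul_mul_tmul, one_mul, mul_one]

theorem commute_inl_inr (a b : Uh) : Commute (inl a) (inr b) := by
  rw [Commute, SemiconjBy, inl_mul_inr, inl_apply, inr_apply, ← map_mul,
    Algebra.TensorProduct.tmul_mul_tmul, one_mul, mul_one]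

/-- The value of the coproduct at `x`. -/
def dx : Uh ⊗[Ch] Uh := x ⊗ₜ[Ch] k + kInv ⊗ₜ[Ch] x

/-- The value of the coproduct at `y`. -/
def dy : Uh ⊗[Ch] Uh := y ⊗ₜ[Ch] k + kInv ⊗ₜ[Ch] y

/-- The value of the coproduct at `H`. -/
def dH : Uh ⊗[Ch] Uh := H ⊗ₜ[Ch] 1 + 1 ⊗ₜ[Ch] H

theorem dH_mul_dx : dH * dx - dx * dH = 2 * dx := by
  simp only [dH, dx, add_mul, mul_add, Algebra.TensorProduct.tmul_mul_tmul, one_mul, mul_one,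
    H_mul_x', H_mul_k, H_mul_kInv, two_mul, TensorProduct.tmul_add, TensorProduct.add_tmul]
  abel

theorem dH_mul_dy : dH * dy - dy * dH = -(2 * dy) := by
  simp only [dH, dy, add_mul, mul_add, Algebra.TensorProduct.tmul_mul_tmul, one_mul, mul_one,
    H_mul_y', H_mul_k, H_mul_kInv, two_mul, TensorProduct.tmul_add, TensorProduct.add_tmul,
    TensorProduct.tmul_sub, TensorProduct.sub_tmul]
  abel

/-- The mixed terms cancel because the powers of `q` from moving `k` and `k⁻¹` past `x` and `y`
agree. -/
theorem dx_mul_dy : dx * dy - dy * dx =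
    bracket H ⊗ₜ[Ch] (k * k) + (kInv * kInv) ⊗ₜ[Ch] bracket H := by
  simp only [dx, dy, add_mul, mul_add, Algebra.TensorProduct.tmul_mul_tmul, ← x_mul_y,
    TensorProduct.tmul_sub, TensorProduct.sub_tmul, kInv_mul_x, kInv_mul_y, k_mul_x, k_mul_y,
    TensorProduct.tmul_smul, TensorProduct.smul_tmul']
  abel

theorem of_bracket_dH : of _ (bracket H ⊗ₜ[Ch] (k * k) + (kInv * kInv) ⊗ₜ[Ch] bracket H) =
    bracket (of (Uh ⊗[Ch] Uh) dH) := by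
  rw [dH, map_add, map_add, ← inl_mul_inr, ← inl_mul_inr, ← inl_mul_inr, ← inl_mul_inr, map_one,
    map_one, mul_one, one_mul, bracket_add (commute_inl_inr H H), map_bracket, map_bracket,
    ← hexp_half, ← hexp_neg_half, map_hser, map_hser,
    map_smul, map_smul]

/-- The coproduct. -/
def comulHom : Uh →ₐ[Ch] T2 Uh :=
  lift (of _ dx) (of _ dy) (of _ dH)
    (by rw [← map_mul, ← map_mul, ← map_sub, dH_mul_dx, map_mul, map_ofNat])
    (by rw [← map_mul, ← map_mul, ← map_sub, dH_mul_dy, map_neg, map_mul, map_ofNat])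
    (by rw [← map_mul, ← map_mul, ← map_sub, dx_mul_dy, of_bracket_dH])

theorem comulHom_x : comulHom x = of _ (x ⊗ₜ[Ch] k + kInv ⊗ₜ[Ch] x) := lift_x _ _ _

theorem comulHom_y : comulHom y = of _ (y ⊗ₜ[Ch] k + kInv ⊗ₜ[Ch] y) := lift_y _ _ _

theorem comulHom_H : comulHom H = of _ (H ⊗ₜ[Ch] 1 + 1 ⊗ₜ[Ch] H) := lift_H _ _ _

/-- The counit. -/
def counitHom : Uh →ₐ[Ch] Ch :=
  lift 0 0 0 (by simp) (by simp) (by rw [bracket_zero]; simp)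

/-- The antipode. -/
def antipodeHom : Uh →ₐ[Ch] Uhᵐᵒᵖ :=
  lift (MulOpposite.op (-(qPow 1 • x))) (MulOpposite.op (-(qPow (-1) • y))) (MulOpposite.op (-H))
    (MulOpposite.unop_injective (by
      simp only [MulOpposite.unop_sub, MulOpposite.unop_mul, MulOpposite.unop_op, two_mul,
        MulOpposite.unop_add, neg_mul_neg, smul_mul_assoc, mul_smul_comm, H_mul_x', smul_add]
      abel))
    (MulOpposite.unop_injective (by
      simp only [MulOpposite.unop_sub, MulOpposite.unop_mul, MulOpposite.unop_op, two_mul,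
        MulOpposite.unop_add, neg_mul_neg, smul_mul_assoc, mul_smul_comm, H_mul_y', smul_add,
        smul_sub, MulOpposite.unop_neg]
      abel))
    (MulOpposite.unop_injective (by
      simp only [MulOpposite.unop_sub, MulOpposite.unop_mul, MulOpposite.unop_op, neg_mul_neg,
        smul_mul_assoc, mul_smul_comm, smul_smul, qPow_mul, bracket_op, bracket_neg, ← x_mul_y]
      simp [qPow_zero]))

section

variable {D : Uh →ₐ[Ch] T2 Uh}

/-- `H` is primitive and its two summands commute, so its exponentials are group-like. Only the
value at `H` enters, so any coproduct with the standard value there qualifies. -/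
theorem comul_hexp (hD : D H = of _ (H ⊗ₜ[Ch] 1 + 1 ⊗ₜ[Ch] H)) (r : ℂ) :
    D (hexp ((C r : Ch) • H)) =
      of _ (hexp ((C r : Ch) • H) ⊗ₜ[Ch] hexp ((C r : Ch) • H)) := by
  rw [map_hser, map_smul, hD, map_add, ← inl_mul_inr, ← inl_mul_inr, ← inl_mul_inr,
    map_one, map_one, mul_one, one_mul, smul_add, ← hexp,
    hexp_add (((commute_inl_inr H H).smul_left _).smul_right _), map_hser, map_hser, map_smul,
    map_smul]

theorem comul_k (hD : D H = of _ (H ⊗ₜ[Ch] 1 + 1 ⊗ₜ[Ch] H)) : D k = of _ (k ⊗ₜ[Ch] k) := by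
  rw [k_eq, comul_hexp hD]

theorem comul_kInv (hD : D H = of _ (H ⊗ₜ[Ch] 1 + 1 ⊗ₜ[Ch] H)) :
    D kInv = of _ (kInv ⊗ₜ[Ch] kInv) := by
  rw [kInv_eq, comul_hexp hD]

end

theorem counitHom_x : counitHom x = 0 := lift_x _ _ _
theorem counitHom_y : counitHom y = 0 := lift_y _ _ _
theorem counitHom_H : counitHom H = 0 := lift_H _ _ _

theorem counitHom_k : counitHom k = 1 := by
  rw [k_eq, map_hser, map_smul, counitHom_H, smul_zero, ← hexp, hexp_zero]

theorem counitHom_kInv : counitHom kInv = 1 := by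
  rw [kInv_eq, map_hser, map_smul, counitHom_H, smul_zero, ← hexp, hexp_zero]

theorem antipodeHom_x : antipodeHom x = MulOpposite.op (-(qPow 1 • x)) := lift_x _ _ _
theorem antipodeHom_y : antipodeHom y = MulOpposite.op (-(qPow (-1) • y)) := lift_y _ _ _
theorem antipodeHom_H : antipodeHom H = MulOpposite.op (-H) := lift_H _ _ _

theorem antipodeHom_k : antipodeHom k = MulOpposite.op kInv := by
  rw [k_eq, map_hser, map_smul, antipodeHom_H, ← MulOpposite.op_smul, hser_op, smul_neg,
    ← neg_smul, ← map_neg, ← neg_div, kInv_eq]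

theorem antipodeHom_kInv : antipodeHom kInv = MulOpposite.op k := by
  rw [kInv_eq, map_hser, map_smul, antipodeHom_H, ← MulOpposite.op_smul, hser_op, smul_neg,
    ← neg_smul, ← map_neg, ← neg_div, neg_neg, k_eq]

/-- The Hopf algebra structure of `U_h(sl₂)`. -/
def hopf : HopfStructure Uh where
  comul := comulHom
  counit := counitHom
  antipode := antipodeHom
  coassoc a := by
    have hH := comulHom_H
    have : (idTensorHom comulHom).comp comulHom = (tensorIdHom comulHom).comp comulHom := by
      refine algHom_ext ?_ ?_ ?_ <;>
      simp only [AlgHom.comp_apply, comulHom_x, comulHom_y, hH, map_add, idTensorHom_of_tmul,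
        tensorIdHom_of_tmul, comul_k hH, comul_kInv hH, leg12_of_tmul, leg23_of, leg1_apply,
        leg3_apply, map_one, mul_one, one_mul, mul_add, add_mul, ← map_mul,
        Algebra.TensorProduct.tmul_mul_tmul]
      · abel
      · abel
      · rw [Algebra.TensorProduct.one_def]
        abel
    rw [← idTensorHom_apply, ← tensorIdHom_apply]
    exact AlgHom.congr_fun this a
  counit_left a := by
    let f := mulHom ((Algebra.ofId Ch (Completion Uh)).comp counitHom) (of Uh)
      fun a b => Algebra.commutes (counitHom a) (of Uh b)
    have hf : ∀ a b, f (of _ (a ⊗ₜ[Ch] b)) = counitHom a • of Uh b := fun a b =>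
      (mulHom_of_tmul _ _ _ a b).trans (Algebra.smul_def (counitHom a) (of Uh b)).symm
    have : f.comp comulHom = of Uh := by
      refine algHom_ext ?_ ?_ ?_ <;>
      simp only [AlgHom.comp_apply, comulHom_x, comulHom_y, comulHom_H, map_add, hf,
        counitHom_x, counitHom_y, counitHom_H, counitHom_kInv, map_one, zero_smul, one_smul,
        zero_add]
    exact (mulHom_apply _ _ _ _).symm.trans (AlgHom.congr_fun this a)
  counit_right a := by
    let f := mulHom (of Uh) ((Algebra.ofId Ch (Completion Uh)).comp counitHom)
      fun a b => (Algebra.commutes (counitHom b) (of Uh a)).symm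
    have hf : ∀ a b, f (of _ (a ⊗ₜ[Ch] b)) = counitHom b • of Uh a := fun a b =>
      (mulHom_of_tmul _ _ _ a b).trans ((Algebra.commutes (counitHom b) (of Uh a)).symm.trans
        (Algebra.smul_def (counitHom b) (of Uh a)).symm)
    have : f.comp comulHom = of Uh := by
      refine algHom_ext ?_ ?_ ?_ <;>
      simp only [AlgHom.comp_apply, comulHom_x, comulHom_y, comulHom_H, map_add, hf,
        counitHom_x, counitHom_y, counitHom_H, counitHom_k, map_one, zero_smul, one_smul,
        add_zero]
    exact (mulHom_apply _ _ _ _).symm.trans (AlgHom.congr_fun this a)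
  antipode_left a := by
    have : mulMap (antiToCompletion antipodeHom) (of Uh).toLinearMap ∘ₗ comulHom.toLinearMap =
        scalarToCompletion counitHom := by
      refine Uh.linearMap_ext ?_ ?_ ?_ ?_ fun a b ha hb => ?_
      · rw [LinearMap.comp_apply, AlgHom.toLinearMap_apply, map_one, ← map_one (of _),
          Algebra.TensorProduct.one_def, mulMap_of_tmul, antiToCompletion_apply,
          scalarToCompletion_apply]
        simp
      · simp only [LinearMap.comp_apply, AlgHom.toLinearMap_apply, comulHom_x, map_add,
          mulMap_of_tmul, antiToCompletion_apply, scalarToCompletion_apply, counitHom_x,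
          antipodeHom_x, antipodeHom_kInv, MulOpposite.unop_op, ← map_mul, neg_mul,
          smul_mul_assoc, k_mul_x, map_neg, zero_smul, neg_add_cancel]
      · simp only [LinearMap.comp_apply, AlgHom.toLinearMap_apply, comulHom_y, map_add,
          mulMap_of_tmul, antiToCompletion_apply, scalarToCompletion_apply, counitHom_y,
          antipodeHom_y, antipodeHom_kInv, MulOpposite.unop_op, ← map_mul, neg_mul,
          smul_mul_assoc, k_mul_y, map_neg, zero_smul, neg_add_cancel]
      · simp only [LinearMap.comp_apply, AlgHom.toLinearMap_apply, comulHom_H, map_add,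
          mulMap_of_tmul, antiToCompletion_apply, scalarToCompletion_apply, counitHom_H,
          antipodeHom_H, map_one, MulOpposite.unop_one, MulOpposite.unop_op, mul_one, one_mul,
          map_neg, zero_smul, neg_add_cancel]
      · rw [LinearMap.comp_apply, AlgHom.toLinearMap_apply, scalarToCompletion_apply] at ha hb ⊢
        rw [map_mul, mulMap_anti_left_mul _ ha, hb, smul_smul, map_mul]
    exact LinearMap.congr_fun this a
  antipode_right a := by
    have : mulMap (of Uh).toLinearMap (antiToCompletion antipodeHom) ∘ₗ comulHom.toLinearMap =
        scalarToCompletion counitHom := by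
      refine Uh.linearMap_ext ?_ ?_ ?_ ?_ fun a b ha hb => ?_
      · rw [LinearMap.comp_apply, AlgHom.toLinearMap_apply, map_one, ← map_one (of _),
          Algebra.TensorProduct.one_def, mulMap_of_tmul, antiToCompletion_apply,
          scalarToCompletion_apply]
        simp
      · simp only [LinearMap.comp_apply, AlgHom.toLinearMap_apply, comulHom_x, map_add,
          mulMap_of_tmul, antiToCompletion_apply, scalarToCompletion_apply, counitHom_x,
          antipodeHom_x, antipodeHom_k, MulOpposite.unop_op, ← map_mul, mul_neg,
          mul_smul_comm, kInv_mul_x, map_neg, zero_smul, smul_smul, qPow_mul]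
        simp [qPow_zero]
      · simp only [LinearMap.comp_apply, AlgHom.toLinearMap_apply, comulHom_y, map_add,
          mulMap_of_tmul, antiToCompletion_apply, scalarToCompletion_apply, counitHom_y,
          antipodeHom_y, antipodeHom_k, MulOpposite.unop_op, ← map_mul, mul_neg,
          mul_smul_comm, kInv_mul_y, map_neg, zero_smul, smul_smul, qPow_mul]
        simp [qPow_zero]
      · simp only [LinearMap.comp_apply, AlgHom.toLinearMap_apply, comulHom_H, map_add,
          mulMap_of_tmul, antiToCompletion_apply, scalarToCompletion_apply, counitHom_H,
          antipodeHom_H, map_one, MulOpposite.unop_one, MulOpposite.unop_op, mul_one, one_mul,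
          map_neg, zero_smul, add_neg_cancel]
      · rw [LinearMap.comp_apply, AlgHom.toLinearMap_apply, scalarToCompletion_apply] at ha hb ⊢
        rw [map_mul, mulMap_anti_right_mul _ hb, ha, smul_smul, map_mul, mul_comm]
    exact LinearMap.congr_fun this a

theorem hopf_hasStandardValues : HasStandardValues hopf where
  comul_x := comulHom_x
  comul_y := comulHom_y
  comul_H := comulHom_H
  counit_x := counitHom_x
  counit_y := counitHom_y
  counit_H := counitHom_H
  antipode_x := by rw [show hopf.antipode = antipodeHom from rfl, antipodeHom_x]; rfl
  antipode_y := by rw [show hopf.antipode = antipodeHom from rfl, antipodeHom_y]; rfl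
  antipode_H := by rw [show hopf.antipode = antipodeHom from rfl, antipodeHom_H]; rfl

theorem HasStandardValues.unique {𝓗 𝓚 : HopfStructure Uh} (h𝓗 : HasStandardValues 𝓗)
    (h𝓚 : HasStandardValues 𝓚) : 𝓗 = 𝓚 := by
  refine HopfStructure.ext (algHom_ext ?_ ?_ ?_) (algHom_ext ?_ ?_ ?_) (algHom_ext ?_ ?_ ?_)
  · rw [h𝓗.comul_x, h𝓚.comul_x]
  · rw [h𝓗.comul_y, h𝓚.comul_y]
  · rw [h𝓗.comul_H, h𝓚.comul_H]
  · rw [h𝓗.counit_x, h𝓚.counit_x]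
  · rw [h𝓗.counit_y, h𝓚.counit_y]
  · rw [h𝓗.counit_H, h𝓚.counit_H]
  · exact MulOpposite.unop_injective (h𝓗.antipode_x.trans h𝓚.antipode_x.symm)
  · exact MulOpposite.unop_injective (h𝓗.antipode_y.trans h𝓚.antipode_y.symm)
  · exact MulOpposite.unop_injective (h𝓗.antipode_H.trans h𝓚.antipode_H.symm)

end Uh

/-! ### The universal R-matrix -/

/-- Passes from series in an argument divisible by `h` to series in the quotient `w`, where the
factor `hⁿ` is supplied by evaluation. -/
theorem Completion.hEval_eq_hser {A : Type} [Ring A] [Algebra Ch A] (c : ℕ → Ch) (z w : A)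
    (hz : z ∈ hIdeal A 1) (hzw : z = h • w) : hEval c z hz = hser c (of A w) := by
  refine hSum_eq_evalPS _ _ _ fun n => ?_
  rw [coeff_serPS, hzw, smul_pow, smul_comm, map_smul, map_smul, map_pow]

namespace Uh

section Normal

variable (a : Uh)

theorem k_mul_x_assoc : k * (x * a) = qPow 1 • (x * (k * a)) := by
  rw [← mul_assoc, k_mul_x, smul_mul_assoc, mul_assoc]

theorem k_mul_y_assoc : k * (y * a) = qPow (-1) • (y * (k * a)) := by
  rw [← mul_assoc, k_mul_y, smul_mul_assoc, mul_assoc]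

theorem kInv_mul_x_assoc : kInv * (x * a) = qPow (-1) • (x * (kInv * a)) := by
  rw [← mul_assoc, kInv_mul_x, smul_mul_assoc, mul_assoc]

theorem kInv_mul_y_assoc : kInv * (y * a) = qPow 1 • (y * (kInv * a)) := by
  rw [← mul_assoc, kInv_mul_y, smul_mul_assoc, mul_assoc]

theorem k_mul_kInv_assoc : k * (kInv * a) = a := by rw [← mul_assoc, k_mul_kInv, one_mul]

theorem kInv_mul_k_assoc : kInv * (k * a) = a := by rw [← mul_assoc, kInv_mul_k, one_mul]

end Normal

/-! ### Conjugation by the Cartan factor, for an arbitrary pair of commuting copies of `U`. -/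

section Pairing

variable {B : Type} [Ring B] [Algebra Ch B] [HComplete B] {α β : Uh →ₐ[Ch] B}

/-- The element `e^{(h/4) α(H) β(H)}`. -/
def cartanExp (α β : Uh →ₐ[Ch] B) : B := hexp ((C (1 / 4) : Ch) • (α H * β H))

variable (hαβ : ∀ a b, Commute (α a) (β b))
include hαβ

theorem cartanExp_swap : cartanExp α β = cartanExp β α := by
  rw [cartanExp, (hαβ H H).eq, cartanExp]

/-- From `[H, y] = -2y`, moving `β y` leftwards past the exponential shifts its exponent by `-(h/2)
α(H)`, that is, by the factor `α(k⁻²)`, which `α(k²)` compensates. -/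
theorem cartanExp_y_right :
    SemiconjBy (cartanExp α β) (α (k * k) * β y) (β y) := by
  have hz : ((C (1 / 4) : Ch) • (α H * β H)) * β y =
      β y * ((C (1 / 4) : Ch) • (α H * β H) + (C (-1 / 2) : Ch) • α H) := by
    have e : β H * β y = β y * β H - 2 * β y := by
      rw [← map_mul, H_mul_y', map_sub, map_mul, map_mul, map_ofNat]
    have e2 : (C (-1 / 2) : Ch) = C (1 / 4) * (-2 : Ch) := by
      rw [← map_ofNat (C (R := ℂ)) 2, ← map_neg, ← map_mul]; norm_num
    rw [smul_mul_assoc, mul_assoc, e, e2, mul_smul, ← smul_add, mul_smul_comm]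
    congr 1
    rw [mul_add, ← mul_assoc, ← (hαβ H y).eq, mul_sub, mul_smul_comm, ← (hαβ H y).eq, neg_smul,
      two_smul, two_mul, mul_add, mul_assoc]
    abel
  have hc : Commute ((C (1 / 4) : Ch) • (α H * β H)) ((C (-1 / 2) : Ch) • α H) :=
    ((((Commute.refl (α H)).mul_left (hαβ H H).symm)).smul_left _).smul_right _
  have h1 : cartanExp α β * β y = β y * (cartanExp α β * α (kInv * kInv)) := by
    rw [cartanExp, hexp, hser_mul _ hz, ← hexp, hexp_add hc, ← map_smul, hexp, hexp, ← map_hser,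
      ← hexp_neg_half]
  rw [SemiconjBy, (hαβ _ _).eq, ← mul_assoc, h1, mul_assoc, mul_assoc, ← map_mul, mul_assoc kInv,
    kInv_mul_k_assoc, kInv_mul_k, map_one, mul_one]

theorem cartanExp_x_right :
    SemiconjBy (cartanExp α β) (α (kInv * kInv) * β x) (β x) := by
  have hz : ((C (1 / 4) : Ch) • (α H * β H)) * β x =
      β x * ((C (1 / 4) : Ch) • (α H * β H) + (C (1 / 2) : Ch) • α H) := by
    have e : β H * β x = β x * β H + 2 * β x := by
      rw [← map_mul, H_mul_x', map_add, map_mul, map_mul, map_ofNat]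
    have e2 : (C (1 / 2) : Ch) = C (1 / 4) * (2 : Ch) := by
      rw [← map_ofNat (C (R := ℂ)) 2, ← map_mul]; norm_num
    rw [smul_mul_assoc, mul_assoc, e, e2, mul_smul, ← smul_add, mul_smul_comm]
    congr 1
    rw [mul_add, mul_add, mul_smul_comm, two_smul, two_mul, mul_add, ← mul_assoc,
      ← mul_assoc (β x), (hαβ H x).eq]
  have hc : Commute ((C (1 / 4) : Ch) • (α H * β H)) ((C (1 / 2) : Ch) • α H) :=
    ((((Commute.refl (α H)).mul_left (hαβ H H).symm)).smul_left _).smul_right _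
  have h1 : cartanExp α β * β x = β x * (cartanExp α β * α (k * k)) := by
    rw [cartanExp, hexp, hser_mul _ hz, ← hexp, hexp_add hc, ← map_smul, hexp, hexp, ← map_hser,
      ← hexp_half]
  rw [SemiconjBy, (hαβ _ _).eq, ← mul_assoc, h1, mul_assoc, mul_assoc, ← map_mul, mul_assoc k,
    k_mul_kInv_assoc, k_mul_kInv, map_one, mul_one]

theorem cartanExp_y_left :
    SemiconjBy (cartanExp α β) (α y * β (k * k)) (α y) := by
  rw [cartanExp_swap hαβ, (hαβ _ _).eq]
  exact cartanExp_y_right fun a b => (hαβ b a).symm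

theorem cartanExp_x_left :
    SemiconjBy (cartanExp α β) (α x * β (kInv * kInv)) (α x) := by
  rw [cartanExp_swap hαβ, (hαβ _ _).eq]
  exact cartanExp_x_right fun a b => (hαβ b a).symm

theorem cartanExp_commute_left {a : Uh} (ha : H * a = a * H) : Commute (cartanExp α β) (α a) := by
  have h1 : Commute (α H) (α a) := by rw [Commute, SemiconjBy, ← map_mul, ha, map_mul]
  exact commute_hser _ ((h1.mul_left (hαβ a H).symm).smul_left _)

theorem cartanExp_commute_right {a : Uh} (ha : H * a = a * H) : Commute (cartanExp α β) (β a) := by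
  rw [cartanExp_swap hαβ]
  exact cartanExp_commute_left (fun a b => (hαβ b a).symm) ha

end Pairing

/-- `a ↦ 1 ⊗ a ⊗ 1`. -/
def leg2 : Uh →ₐ[Ch] T3 Uh := (leg23 Uh).comp inl

theorem leg2_apply (a : Uh) : leg2 a = of _ (1 ⊗ₜ[Ch] (a ⊗ₜ[Ch] 1)) := rfl

theorem commute_leg1_leg2 (a b : Uh) : Commute (leg1 Uh a) (leg2 b) := commute_leg1_leg23 _ _

theorem commute_leg1_leg3 (a b : Uh) : Commute (leg1 Uh a) (leg3 Uh b) :=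
  commute_leg1_leg23 a (inr b)

theorem commute_leg2_leg3 (a b : Uh) : Commute (leg2 a) (leg3 Uh b) :=
  (commute_inl_inr a b).map (leg23 Uh)

/-- The scalar `q⁻¹ (q - q⁻¹) / h`. -/
def lam : Ch := qPow (-1) * divh qDiff

theorem h_mul_lam : h * lam = qPow (-1) * qDiff := by
  rw [lam, mul_left_comm, ← qDiff_eq]

/-- `k x ⊗ k⁻¹ y`. -/
def kxky : Uh ⊗[Ch] Uh := (k * x) ⊗ₜ[Ch] (kInv * y)

theorem exp_cartan : Completion.exp cartan cartan_mem = cartanExp inl inr := by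
  rw [Completion.exp, hEval_eq_hser _ _ ((C (1 / 4) : Ch) • (H ⊗ₜ[Ch] H)), map_smul,
    ← inl_mul_inr]
  · rfl
  · rw [cartan, smul_smul]

theorem qExp_nilp : qExp nilp nilp_mem = hser qCoef (lam • of _ kxky) := by
  rw [qExp, hEval_eq_hser _ _ (lam • kxky), map_smul]
  · rfl
  · rw [nilp, smul_smul, h_mul_lam, kxky]

theorem R_eq_exp_mul_qExp :
    R = Completion.exp cartan cartan_mem * qExp nilp nilp_mem := by
  have : rTerm = fun n : ℕ => (qPow (n * (n - 1) / 2) * (qFact n)⁻¹) • nilp ^ n := by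
    funext n
    rw [rTerm, nilp, smul_pow, Algebra.TensorProduct.tmul_pow, smul_smul, mul_pow, qPow_pow]
    congr 1
    have e : qPow (n * (n - 3) / 2) = qPow (n * (n - 1) / 2) * qPow (n * -1) := by
      rw [qPow_mul]; ring_nf
    rw [e]
    ring
  simp only [R, qExp, hEval, this]

theorem R_eq : R = cartanExp inl inr * hser qCoef (lam • of _ kxky) := by
  rw [R_eq_exp_mul_qExp, exp_cartan, qExp_nilp]

theorem isUnit_R : IsUnit R := by
  rw [R_eq]
  exact (isUnit_hser isGauss_expCoef.zero _).mul (isUnit_hser isGauss_qCoef.zero _)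

theorem map_cartanExp {A B : Type} [Ring A] [Algebra Ch A] [HComplete A] [Ring B] [Algebra Ch B]
    [HComplete B] (φ : A →ₐ[Ch] B) (α β : Uh →ₐ[Ch] A) :
    φ (cartanExp α β) = cartanExp (φ.comp α) (φ.comp β) := by
  rw [cartanExp, map_hser, map_smul, map_mul]
  rfl

theorem leg12_R : leg12 Uh R = cartanExp (leg1 Uh) leg2 *
    hser qCoef (lam • (leg1 Uh (k * x) * leg2 (kInv * y))) := by
  rw [R_eq, map_mul, map_hser, map_smul, map_cartanExp, kxky, ← inl_mul_inr, map_mul]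
  rfl

theorem leg13_R : leg13 Uh R = cartanExp (leg1 Uh) (leg3 Uh) *
    hser qCoef (lam • (leg1 Uh (k * x) * leg3 Uh (kInv * y))) := by
  rw [R_eq, map_mul, map_hser, map_smul, map_cartanExp, kxky, ← inl_mul_inr, map_mul]
  rfl

theorem leg23_R : leg23 Uh R = cartanExp leg2 (leg3 Uh) *
    hser qCoef (lam • (leg2 (k * x) * leg3 Uh (kInv * y))) := by
  rw [R_eq, map_mul, map_hser, map_smul, map_cartanExp, kxky, ← inl_mul_inr, map_mul]
  rfl

/-! ### The two hexagon identities. -/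

section Hexagon

variable {D : Uh →ₐ[Ch] T2 Uh}

/-- `Δ(kx) = kx ⊗ k² + 1 ⊗ kx` splits the exponent as `a + b`. The extra `k²` in `a` gives `ba =
q⁻²ab`, and conjugation by the Cartan factor in legs 2 and 3 removes it. -/
theorem tensorIdHom_R (hDH : D H = of _ (H ⊗ₜ[Ch] 1 + 1 ⊗ₜ[Ch] H))
    (hDx : D x = of _ (x ⊗ₜ[Ch] k + kInv ⊗ₜ[Ch] x)) :
    tensorIdHom D R = leg13 Uh R * leg23 Uh R := by
  set a : T3 Uh := lam • (leg1 Uh (k * x) * leg2 (k * k) * leg3 Uh (kInv * y)) with ha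
  set b : T3 Uh := lam • (leg2 (k * x) * leg3 Uh (kInv * y)) with hb
  have hC : tensorIdHom D (cartanExp inl inr) =
      cartanExp (leg1 Uh) (leg3 Uh) * cartanExp leg2 (leg3 Uh) := by
    have hcomm : Commute (leg1 Uh H * leg3 Uh H) (leg2 H * leg3 Uh H) :=
      ((commute_leg1_leg2 _ _).mul_right (commute_leg1_leg3 _ _)).mul_left
        ((commute_leg2_leg3 _ _).symm.mul_right (Commute.refl _))
    rw [cartanExp, cartanExp, cartanExp, ← hexp_add ((hcomm.smul_left _).smul_right _), map_hser,
      map_smul, inl_mul_inr, tensorIdHom_of_tmul, hDH, map_add, map_add, add_mul, smul_add]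
    rfl
  have hN : tensorIdHom D (lam • of _ kxky) = a + b := by
    rw [map_smul, kxky, tensorIdHom_of_tmul, map_mul D, comul_k hDH, hDx, ha, hb, ← smul_add]
    congr 1
    simp only [← map_mul, ← map_add, mul_add, Algebra.TensorProduct.tmul_mul_tmul, k_mul_kInv,
      leg1_apply, leg2_apply, leg3_apply, one_mul, mul_one]
    simp only [map_add, leg12_of_tmul, add_mul, ← map_mul, Algebra.TensorProduct.tmul_mul_tmul,
      one_mul, mul_one]
  have hba : b * a = qPow (-2) • (a * b) := by
    have hc : (leg2 (k * x) * leg3 Uh (kInv * y)) *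
        (leg1 Uh (k * x) * leg2 (k * k) * leg3 Uh (kInv * y)) = qPow (-2) •
        ((leg1 Uh (k * x) * leg2 (k * k) * leg3 Uh (kInv * y)) *
          (leg2 (k * x) * leg3 Uh (kInv * y))) := by
      simp only [leg1_apply, leg2_apply, leg3_apply, ← map_mul, ← map_smul,
        Algebra.TensorProduct.tmul_mul_tmul, one_mul, mul_one]
      congr 1
      simp only [mul_assoc, k_mul_x_assoc, k_mul_x, kInv_mul_y_assoc, kInv_mul_y, smul_mul_assoc,
        mul_smul_comm, smul_smul,
        qPow_mul, TensorProduct.tmul_smul, ← TensorProduct.smul_tmul']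
      norm_num
    rw [ha, hb, smul_mul_smul_comm, smul_mul_smul_comm, hc, smul_comm]
  have hsemi : SemiconjBy (cartanExp leg2 (leg3 Uh)) a
      (lam • (leg1 Uh (k * x) * leg3 Uh (kInv * y))) := by
    have h1 : SemiconjBy (cartanExp leg2 (leg3 Uh)) (leg1 Uh (k * x)) (leg1 Uh (k * x)) :=
      commute_hser _ (((commute_leg1_leg2 _ _).symm.mul_left
        (commute_leg1_leg3 _ _).symm).smul_left _)
    have h2 := cartanExp_commute_right commute_leg2_leg3 H_mul_kInv
    have h3 := h1.mul_right (h2.semiconjBy.mul_right (cartanExp_y_right commute_leg2_leg3))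
    rw [ha, map_mul (leg3 Uh), mul_assoc (leg1 Uh _), ← mul_assoc (leg2 _),
      (commute_leg2_leg3 _ _).eq, mul_assoc (leg3 Uh _)]
    rw [SemiconjBy, mul_smul_comm, smul_mul_assoc, h3.eq]
  rw [R_eq, map_mul, map_hser, hC, hN, hser_add isGauss_qCoef hba, ← R_eq, leg13_R, leg23_R,
    ← hb, mul_assoc, mul_assoc, ← mul_assoc (hser _ _) (cartanExp _ _), hser_mul _ hsemi.eq.symm,
    mul_assoc (cartanExp leg2 _)]

/-- Here `Δ(k⁻¹y) = k⁻¹y ⊗ 1 + k⁻² ⊗ k⁻¹y`, and the extra `k⁻²` in leg 2 is removed by the Cartan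
factor in legs 1 and 2. -/
theorem idTensorHom_R (hDH : D H = of _ (H ⊗ₜ[Ch] 1 + 1 ⊗ₜ[Ch] H))
    (hDy : D y = of _ (y ⊗ₜ[Ch] k + kInv ⊗ₜ[Ch] y)) :
    idTensorHom D R = leg13 Uh R * leg12 Uh R := by
  set a : T3 Uh := lam • (leg1 Uh (k * x) * leg2 (kInv * kInv) * leg3 Uh (kInv * y)) with ha
  set b : T3 Uh := lam • (leg1 Uh (k * x) * leg2 (kInv * y)) with hb
  have hC : idTensorHom D (cartanExp inl inr) =
      cartanExp (leg1 Uh) (leg3 Uh) * cartanExp (leg1 Uh) leg2 := by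
    have hcomm : Commute (leg1 Uh H * leg3 Uh H) (leg1 Uh H * leg2 H) :=
      ((Commute.refl _).mul_right (commute_leg1_leg2 _ _)).mul_left
        ((commute_leg1_leg3 _ _).symm.mul_right (commute_leg2_leg3 _ _).symm)
    rw [cartanExp, cartanExp, cartanExp, ← hexp_add ((hcomm.smul_left _).smul_right _), map_hser,
      map_smul, inl_mul_inr, idTensorHom_of_tmul, hDH, map_add, map_add, mul_add, smul_add,
      add_comm]
    rfl
  have hN : idTensorHom D (lam • of _ kxky) = a + b := by
    rw [map_smul, kxky, idTensorHom_of_tmul, map_mul D, comul_kInv hDH, hDy, ha, hb, ← smul_add,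
      add_comm]
    congr 1
    simp only [← map_mul, mul_add, Algebra.TensorProduct.tmul_mul_tmul, kInv_mul_k,
      leg1_apply, leg2_apply, leg3_apply, one_mul, mul_one]
    simp only [map_add, leg23_of, mul_add, ← map_mul, Algebra.TensorProduct.tmul_mul_tmul,
      one_mul, mul_one]
  have hba : b * a = qPow (-2) • (a * b) := by
    have hc : (leg1 Uh (k * x) * leg2 (kInv * y)) *
        (leg1 Uh (k * x) * leg2 (kInv * kInv) * leg3 Uh (kInv * y)) = qPow (-2) •
        ((leg1 Uh (k * x) * leg2 (kInv * kInv) * leg3 Uh (kInv * y)) *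
          (leg1 Uh (k * x) * leg2 (kInv * y))) := by
      simp only [leg1_apply, leg2_apply, leg3_apply, ← map_mul, ← map_smul,
        Algebra.TensorProduct.tmul_mul_tmul, one_mul, mul_one]
      congr 1
      simp only [mul_assoc, k_mul_x_assoc, k_mul_x, kInv_mul_y_assoc, kInv_mul_y, smul_mul_assoc,
        mul_smul_comm, smul_smul,
        qPow_mul, TensorProduct.tmul_smul, ← TensorProduct.smul_tmul']
      norm_num
    rw [ha, hb, smul_mul_smul_comm, smul_mul_smul_comm, hc, smul_comm]
  have hsemi : SemiconjBy (cartanExp (leg1 Uh) leg2) a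
      (lam • (leg1 Uh (k * x) * leg3 Uh (kInv * y))) := by
    have h1 : SemiconjBy (cartanExp (leg1 Uh) leg2) (leg3 Uh (kInv * y)) (leg3 Uh (kInv * y)) :=
      commute_hser _ (((commute_leg1_leg3 _ _).mul_left (commute_leg2_leg3 _ _)).smul_left _)
    have h2 := cartanExp_commute_left commute_leg1_leg2 H_mul_k
    have h3 := (h2.semiconjBy.mul_right (cartanExp_x_left commute_leg1_leg2)).mul_right h1
    rw [ha, map_mul (leg1 Uh), mul_assoc (leg1 Uh k)]
    rw [SemiconjBy, mul_smul_comm, smul_mul_assoc, h3.eq]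
  rw [R_eq, map_mul, map_hser, hC, hN, hser_add isGauss_qCoef hba, ← R_eq, leg13_R, leg12_R,
    ← hb, mul_assoc, mul_assoc, ← mul_assoc (hser _ _) (cartanExp _ _), hser_mul _ hsemi.eq.symm,
    mul_assoc (cartanExp (leg1 Uh) leg2)]

end Hexagon

/-! ### Quasi-cocommutativity -/

theorem R_mul_dH : of _ (1 ⊗ₜ[Ch] H + H ⊗ₜ[Ch] 1) * R = R * of _ (H ⊗ₜ[Ch] 1 + 1 ⊗ₜ[Ch] H) := by
  rw [add_comm]
  have h1 : Commute (cartanExp inl inr) (of _ (H ⊗ₜ[Ch] 1 + 1 ⊗ₜ[Ch] H)) := by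
    rw [map_add, ← inl_apply, ← inr_apply]
    exact (cartanExp_commute_left commute_inl_inr rfl).add_right
      (cartanExp_commute_right commute_inl_inr rfl)
  have h2 : Commute (kxky) (H ⊗ₜ[Ch] 1 + 1 ⊗ₜ[Ch] H) := by
    have hx : H * (k * x) = k * x * H + 2 * (k * x) := by
      rw [← mul_assoc, H_mul_k, mul_assoc, H_mul_x', mul_add, ← mul_assoc, two_mul, two_mul,
        mul_add]
    have hy : H * (kInv * y) = kInv * y * H - 2 * (kInv * y) := by
      rw [← mul_assoc, H_mul_kInv, mul_assoc, H_mul_y', mul_sub, ← mul_assoc, two_mul, two_mul,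
        mul_add]
    rw [Commute, SemiconjBy, kxky]
    simp only [mul_add, add_mul, Algebra.TensorProduct.tmul_mul_tmul, one_mul, mul_one, hx, hy,
      TensorProduct.add_tmul, TensorProduct.tmul_sub, two_mul, TensorProduct.tmul_add]
    abel
  have h3 := commute_hser qCoef ((h2.map (of (Uh ⊗[Ch] Uh))).smul_left lam)
  rw [R_eq]
  exact (h1.mul_left h3).eq.symm

/-- With coproduct `P + S` and opposite coproduct `Q`, the quantum exponential carries `P + S` to `P
+ T` and the Cartan factor carries `P + T` to `Q`. -/
theorem twist_mul_R {P S T Q : Uh ⊗[Ch] Uh}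
    (hQ : SemiconjBy (cartanExp inl inr) (of _ (P + T)) (of _ Q))
    (hP : (qPow (-1) * qDiff) • (P * kxky - kxky * P) = S - T)
    (hS : S * kxky = qPow (-2) • (kxky * S)) (hT : kxky * T = qPow (-2) • (T * kxky)) :
    of _ Q * R = R * of _ (P + S) := by
  have := hser_intertwine isGauss_qCoef (w := lam • of _ kxky) (P := of _ P) (S := of _ S)
    (T := of _ T) (by
      rw [mul_smul_comm, smul_mul_assoc, ← smul_sub, smul_smul, h_mul_lam, ← map_mul, ← map_mul,
        ← map_sub, ← map_smul, hP, map_sub])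
    (by rw [mul_smul_comm, smul_mul_assoc, ← map_mul, hS, ← map_mul, map_smul, smul_comm])
    (by rw [mul_smul_comm, smul_mul_assoc, ← map_mul, hT, ← map_mul, map_smul, smul_comm])
  rw [← map_add, ← map_add] at this
  rw [R_eq, ← mul_assoc, ← hQ.eq, mul_assoc, ← this, mul_assoc]

theorem R_mul_dx : of _ (k ⊗ₜ[Ch] x + x ⊗ₜ[Ch] kInv) * R =
    R * of _ (x ⊗ₜ[Ch] k + kInv ⊗ₜ[Ch] x) := by
  rw [add_comm (x ⊗ₜ[Ch] k)]
  -- With `P = k⁻¹⊗x` and `S = x⊗k`, the commutator contributes `x ⊗ (k² - k⁻²)k⁻¹ = x⊗k - x⊗k⁻³`,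
  -- which dictates `T`.
  refine twist_mul_R (T := x ⊗ₜ[Ch] (kInv * kInv * kInv)) ?_ ?_ ?_ ?_
  · have h1 := (cartanExp_commute_left commute_inl_inr H_mul_k).semiconjBy.mul_right
      (cartanExp_x_right commute_inl_inr)
    have h2 := (cartanExp_x_left commute_inl_inr).mul_right
      (cartanExp_commute_right commute_inl_inr H_mul_kInv).semiconjBy
    have h3 := h1.add_right h2
    rw [← mul_assoc, ← map_mul, mul_assoc (inl x), ← map_mul, inl_mul_inr, inl_mul_inr,
      inl_mul_inr, inl_mul_inr, ← map_add, ← map_add, k_mul_kInv_assoc] at h3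
    exact h3
  · have e : kInv ⊗ₜ[Ch] x * kxky - kxky * kInv ⊗ₜ[Ch] x =
        qPow 1 • (x ⊗ₜ[Ch] (bracket H * kInv)) := by
      rw [← x_mul_y, kxky]
      simp only [sub_mul, TensorProduct.tmul_sub, smul_sub,
        Algebra.TensorProduct.tmul_mul_tmul, mul_assoc, k_mul_x, kInv_mul_x_assoc, kInv_mul_x,
        kInv_mul_y, k_mul_kInv, kInv_mul_k, mul_one, smul_mul_assoc, mul_smul_comm, smul_smul,
        qPow_mul, TensorProduct.tmul_smul, ← TensorProduct.smul_tmul']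
      norm_num [qPow_zero]
    rw [e, smul_smul, mul_right_comm, qPow_mul, neg_add_cancel, qPow_zero, one_mul,
      ← TensorProduct.tmul_smul, ← smul_mul_assoc, qDiff_smul_bracket_H, sub_mul, mul_assoc k,
      k_mul_kInv, mul_one, TensorProduct.tmul_sub]
  · simp only [kxky, Algebra.TensorProduct.tmul_mul_tmul, mul_assoc, k_mul_x, k_mul_y_assoc,
        kInv_mul_y, k_mul_kInv, kInv_mul_k, mul_one, smul_mul_assoc, mul_smul_comm, smul_smul,
        qPow_mul, TensorProduct.tmul_smul, ← TensorProduct.smul_tmul']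
    norm_num
  · simp only [kxky, Algebra.TensorProduct.tmul_mul_tmul, mul_assoc, k_mul_x, kInv_mul_y_assoc,
      kInv_mul_y, smul_mul_assoc, mul_smul_comm, smul_smul,
        qPow_mul, TensorProduct.tmul_smul, ← TensorProduct.smul_tmul']
    norm_num

theorem R_mul_dy : of _ (k ⊗ₜ[Ch] y + y ⊗ₜ[Ch] kInv) * R =
    R * of _ (y ⊗ₜ[Ch] k + kInv ⊗ₜ[Ch] y) := by
  -- Now `P = y⊗k`, `S = k⁻¹⊗y`, and the commutator contributes `-(k² - k⁻²)k ⊗ y = k⁻¹⊗y - k³⊗y`.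
  refine twist_mul_R (T := (k * k * k) ⊗ₜ[Ch] y) ?_ ?_ ?_ ?_
  · have h1 := (cartanExp_commute_left commute_inl_inr H_mul_k).semiconjBy.mul_right
      (cartanExp_y_right commute_inl_inr)
    have h2 := (cartanExp_y_left commute_inl_inr).mul_right
      (cartanExp_commute_right commute_inl_inr H_mul_kInv).semiconjBy
    have h3 := h1.add_right h2
    rw [← mul_assoc, ← map_mul, mul_assoc (inl y), ← map_mul, inl_mul_inr, inl_mul_inr,
      inl_mul_inr, inl_mul_inr, ← map_add, ← map_add, mul_assoc k k kInv, k_mul_kInv, mul_one,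
      add_comm, ← mul_assoc k] at h3
    exact h3
  · have e : y ⊗ₜ[Ch] k * kxky - kxky * y ⊗ₜ[Ch] k =
        -(qPow 1 • ((bracket H * k) ⊗ₜ[Ch] y)) := by
      rw [← x_mul_y, kxky]
      simp only [sub_mul, TensorProduct.sub_tmul, smul_sub,
        Algebra.TensorProduct.tmul_mul_tmul, mul_assoc, k_mul_x, k_mul_y_assoc,
        k_mul_y, kInv_mul_y, k_mul_kInv, kInv_mul_k, mul_one, smul_mul_assoc, mul_smul_comm,
        smul_smul,
        qPow_mul, TensorProduct.tmul_smul, ← TensorProduct.smul_tmul']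
      norm_num [qPow_zero]
    rw [e, smul_neg, smul_smul, mul_right_comm, qPow_mul, neg_add_cancel, qPow_zero, one_mul,
      TensorProduct.smul_tmul', ← smul_mul_assoc, qDiff_smul_bracket_H, sub_mul,
      mul_assoc kInv, kInv_mul_k, mul_one, TensorProduct.sub_tmul, neg_sub]
  · simp only [kxky, Algebra.TensorProduct.tmul_mul_tmul, mul_assoc, k_mul_x, kInv_mul_x_assoc,
      kInv_mul_y, k_mul_kInv, kInv_mul_k, mul_one, smul_mul_assoc, mul_smul_comm, smul_smul,
        qPow_mul, TensorProduct.tmul_smul, ← TensorProduct.smul_tmul']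
    norm_num
  · simp only [kxky, Algebra.TensorProduct.tmul_mul_tmul, mul_assoc, k_mul_x_assoc, k_mul_x,
      kInv_mul_y, smul_mul_assoc, mul_smul_comm, smul_smul,
        qPow_mul, TensorProduct.tmul_smul, ← TensorProduct.smul_tmul']
    norm_num

/-- The intertwining relation is linear in `a` and passes to products, so it suffices to check it on
generators. -/
theorem semiconjBy_of_generators {B : Type} [Ring B] [Algebra Ch B] [HComplete B]
    {f g : Uh →ₐ[Ch] B} {r : B} (hx : f x * r = r * g x) (hy : f y * r = r * g y)
    (hH : f H * r = r * g H) (a : Uh) : f a * r = r * g a := by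
  have key : LinearMap.mulRight Ch r ∘ₗ f.toLinearMap = LinearMap.mulLeft Ch r ∘ₗ g.toLinearMap := by
    refine linearMap_ext ?_ hx hy hH fun a b ha hb => ?_ <;>
    simp only [LinearMap.comp_apply, LinearMap.mulRight_apply, LinearMap.mulLeft_apply,
      AlgHom.toLinearMap_apply, map_mul, map_one, one_mul, mul_one] at *
    rw [mul_assoc, hb, ← mul_assoc, ha, mul_assoc]
  exact LinearMap.congr_fun key a

theorem HasStandardValues.twist_mul_R {𝓗 : HopfStructure Uh} (h𝓗 : HasStandardValues 𝓗) (a : Uh) :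
    twist Uh (𝓗.comul a) * R = R * 𝓗.comul a := by
  refine semiconjBy_of_generators (f := (twist Uh).comp 𝓗.comul) (g := 𝓗.comul) (r := R) ?_ ?_ ?_ a
  · rw [AlgHom.comp_apply, h𝓗.comul_x, ← R_mul_dx, map_add, map_add, twist_of_tmul, twist_of_tmul,
      map_add]
  · rw [AlgHom.comp_apply, h𝓗.comul_y, ← R_mul_dy, map_add, map_add, twist_of_tmul, twist_of_tmul,
      map_add]
  · rw [AlgHom.comp_apply, h𝓗.comul_H, ← R_mul_dH, map_add, map_add, twist_of_tmul, twist_of_tmul,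
      map_add]

theorem HasStandardValues.isUniversalRMatrix {𝓗 : HopfStructure Uh} (h𝓗 : HasStandardValues 𝓗) :
    IsUniversalRMatrix 𝓗 R where
  isUnit := isUnit_R
  conj a := by rw [← h𝓗.twist_mul_R, mul_assoc, Ring.mul_inverse_cancel _ isUnit_R, mul_one]
  comul_id := by rw [← tensorIdHom_apply, tensorIdHom_R h𝓗.comul_H h𝓗.comul_x]
  id_comul := by rw [← idTensorHom_apply, idTensorHom_R h𝓗.comul_H h𝓗.comul_y]

end Uh

end QuantumSl2

end

theorem theoremT :
    (∃! 𝓗 : HopfStructure Uh, Uh.HasStandardValues 𝓗) ∧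
    (∀ 𝓗 : HopfStructure Uh, Uh.HasStandardValues 𝓗 → IsUniversalRMatrix 𝓗 Uh.R) ∧
    Uh.R = Completion.exp Uh.cartan Uh.cartan_mem * qExp Uh.nilp Uh.nilp_mem := by
  exact ⟨⟨Uh.hopf, Uh.hopf_hasStandardValues, fun _ h𝓗 => h𝓗.unique Uh.hopf_hasStandardValues⟩,
    fun _ h𝓗 => h𝓗.isUniversalRMatrix, Uh.R_eq_exp_mul_qExp⟩
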